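/- Let $\mathcal S$ be a triangulated category with suspension $\Sigma$. Write $\mathrm{Mod}\text{-}\mathcal S$ for the category of additive functors $\mathcal S^{op}\to\mathrm{Ab}$ and $Y:\mathcal S\to\mathrm{Mod}\text{-}\mathcal S$, $Y(X)=\mathrm{Hom}(-,X)$, for the Yoneda functor; for a class $\mathcal B$ of objects let ${}^\perp\mathcal B=\{x:\mathrm{Hom}(x,b)=0\ \forall b\in\mathcal B\}$ and $\mathcal B^\perp=\{x:\mathrm{Hom}(b,x)=0\ \forall b\in\mathcal B\}$. Good metrics. A good metric on $\mathcal S$ is a sequence $\{\mathcal M_i\}_{i\in\mathbb N}$ of full subcategories containing $0$ such that $\mathcal M_i*\mathcal M_i\subset\mathcal M_i$ (if $a\to b\to c\to\Sigma a$ is distinguished and $a,c\in\mathcal M_i$, then $b\in\mathcal M_i$) and $\Sigma^{-1}\mathcal M_{i+1}\cup\mathcal M_{i+1}\cup\Sigma\mathcal M_{i+1}\subset\mathcal M_i$. A sequence $E_*=(E_0\to E_1\to\cdots)$ in $\mathcal S$ is Cauchy if for every $i$ there is $N$ such that, for all $n>m\ge N$ and every distinguished triangle $E_m\to E_n\to D\to\Sigma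 E_m$, one has $D\in\mathcal M_i$. A Cauchy sequence of triangles is a sequence of distinguished triangles $a_*\to b_*\to c_*\to\Sigma a_*$ in $\mathcal S$ with $a_*,b_*,c_*$ Cauchy; the colimits in $\mathrm{Mod}\text{-}\mathcal S$ of the images of such sequences under $Y$ are called strong triangles. Completions. Let $\mathfrak L(\mathcal S)\subset\mathrm{Mod}\text{-}\mathcal S$ be the full subcategory of objects $\mathrm{colim}\,Y(E_*)$ with $E_*$ Cauchy; let $\mathcal L_i\subset\mathfrak L(\mathcal S)$ be the full subcategory of those $\mathrm{colim}\,Y(E_*)$ with $E_*$ a Cauchy sequence in $\mathcal M_i$; put $\mathfrak S(\mathcal S)=\mathfrak L(\mathcal S)\cap\bigcup_iY(\mathcal M_i)^\perp$ and $\mathcal N_i=\mathcal L_i\cap\mathfrak S(\mathcal S)$. The distinguished triangles of $\mathfrak S(\mathcal S)$ are the strong triangles whose objects lie in $\mathfrak S(\mathcal S)$. The same constructions, applied to $\mathfrak S(\mathcal S)^{op}$ with the opposite distinguished triangles and the sequence $\{\mathcal N_i^{op}\}$, give $\widehat{\mathcal L}_i\subset\mathfrak L(\mathfrak S(\mathcal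 S)^{op})\subset\mathrm{Mod}\text{-}(\mathfrak S(\mathcal S)^{op})$. Type-$m$ morphisms. A map $f_*:a_*\to b_*$ of Cauchy sequences in $\mathcal S$ is of type $m$ if, in every completion to a Cauchy sequence of triangles $a_*\to b_*\to c_*\to\Sigma a_*$, one has $c_i\in\mathcal M_m$ for $i\gg0$. If $A=\mathrm{colim}\,Y(a_*)$ and $B=\mathrm{colim}\,Y(b_*)$, a morphism $A\to B$ is of type $m$ with respect to $(a_*,b_*)$ if it is the colimit of a type-$m$ map from a subsequence of $a_*$ to a subsequence of $b_*$. Excellent metrics. A good metric is excellent if (i) $\mathcal S=\bigcup_i{}^\perp\mathcal M_i$; (ii) for every $m$ there is $n>m$ such that every $F\in\mathcal S$ admits a distinguished triangle $E\to F\to D\to\Sigma E$ with $E\in{}^\perp\mathcal M_n$ and $D\in\mathcal M_m$; (iii) for every $m$ there is $n>m$ such that every $F\in\mathcal S$ admits a Cauchy sequence $d_*$ in $\mathcal S$ with $D=\mathrm{colim}\,Y(d_*)\in\mathfrak S(\mathcal S)\cap\mathcal L_n^\perp$ and a morphism $Y(F)\to D$ of type $m$ with respect to $(F,d_*)$, where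 $F$ denotes the constant sequence. Proposition. Let $\mathcal S$ be a triangulated category with an excellent metric $\{\mathcal M_i\}_{i\in\mathbb N}$. Then the functor $\widehat Y:(\mathrm{Mod}\text{-}\mathcal S)^{op}\to\mathrm{Mod}\text{-}(\mathfrak S(\mathcal S)^{op})$, $M\mapsto\mathrm{Hom}(M,-)|_{\mathfrak S(\mathcal S)}$, restricts to an equivalence of categories $\mathfrak L(\mathcal S)^{op}\simeq\mathfrak L(\mathfrak S(\mathcal S)^{op})$. For every $\ell$ this further restricts to an equivalence $\mathcal L_\ell^{op}\simeq\widehat{\mathcal L}_\ell$. -/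

import Mathlib

open CategoryTheory CategoryTheory.Limits CategoryTheory.Pretriangulated Opposite

universe v u

noncomputable section

namespace MetricCompletion

/-! ### Modules over a preadditive category and sequences of representables -/

section Modules

variable (C : Type u) [Category.{v} C] [Preadditive C]

/-- `Mod-C`: the category of right `C`-modules, i.e. additive functors `Cᵒᵖ ⥤ Ab`. -/
abbrev RMod := Cᵒᵖ ⥤+ AddCommGrpCat.{v}

/-- The Yoneda functor `Y : C ⥤ Mod-C`, `X ↦ Hom(-, X)`. -/
def yonedaMod : C ⥤ RMod C :=
  (additiveFunctor Cᵒᵖ AddCommGrpCat.{v}).lift preadditiveYoneda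
    fun X => inferInstanceAs (preadditiveYoneda.obj X).Additive

variable {C}

/-- The datum exhibiting a module `F` as `colim Y(E_*)`, for a sequence
`E_0 ⟶ E_1 ⟶ E_2 ⟶ ⋯` in `C`. -/
structure SeqColimit (E : ℕ ⥤ C) (F : RMod C) where
  /-- the colimit cocone -/
  ι : E ⋙ yonedaMod C ⟶ (Functor.const ℕ).obj F
  /-- the cocone is a colimit in `Mod-C` -/
  isColimit : IsColimit (Cocone.mk F ι)

/-- `Y(X)` is the colimit of the image under `Y` of the constant sequence `X = X = X = ⋯`. -/
def constSeqColimit (X : C) : SeqColimit ((Functor.const ℕ).obj X) ((yonedaMod C).obj X) where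
  ι := { app := fun _ => 𝟙 _ }
  isColimit :=
    { desc := fun s => s.ι.app 0
      fac := fun s j => by
        have h := s.ι.naturality (homOfLE (Nat.zero_le j))
        simp at h ⊢
        exact h.symm
      uniq := fun s m hm => by
        have h := hm 0
        simp at h ⊢
        exact h }

/-- The subsequence of `E` with indices `φ 0 < φ 1 < φ 2 < ⋯`. -/
def subseq (E : ℕ ⥤ C) {φ : ℕ → ℕ} (hφ : StrictMono φ) : ℕ ⥤ C :=
  hφ.monotone.functor ⋙ E

end Modules

/-! ### Cauchy sequences and completion

The notions of Cauchy sequence, of the completion and of the balls in the completion depend,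
besides the sequence of full subcategories `M i`, only on the relation
"`X ⟶ Y ⟶ D` can be completed to a distinguished triangle `X ⟶ Y ⟶ D ⟶ ΣX`"
between a morphism `X ⟶ Y` and an object `D`. They are stated in terms of that relation, so that
they apply to a triangulated category `S` as well as to the category `𝔖(S)ᵒᵖ` below. -/

section Completion

variable {C : Type u} [Category.{v} C]

variable (C) in
/-- A relation between morphisms `f : X ⟶ Y` and objects `D`; to be thought of as
"`D` is the third object of some distinguished triangle on `f`". -/
abbrev ConeRel := ∀ ⦃X Y : C⦄, (X ⟶ Y) → ObjectProperty C

/-- A sequence `E_0 ⟶ E_1 ⟶ ⋯` is Cauchy if, for every `i`, there is `N` such that for all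
`N ≤ m < n` and every distinguished triangle `E_m ⟶ E_n ⟶ D ⟶ ΣE_m`, one has `D ∈ M i`. -/
def IsCauchy (cone : ConeRel C) (M : ℕ → ObjectProperty C) (E : ℕ ⥤ C) : Prop :=
  ∀ i : ℕ, ∃ N : ℕ, ∀ (m n : ℕ) (hmn : m < n), N ≤ m →
    ∀ D : C, cone (E.map (homOfLE hmn.le)) D → M i D

variable [Preadditive C]

/-- `𝔏(C) ⊆ Mod-C`: the modules `colim Y(E_*)` with `E_*` a Cauchy sequence. -/
def completion (cone : ConeRel C) (M : ℕ → ObjectProperty C) : ObjectProperty (RMod C) :=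
  fun F => ∃ E : ℕ ⥤ C, IsCauchy cone M E ∧ Nonempty (SeqColimit E F)

/-- `ℒ_i ⊆ 𝔏(C)`: the modules `colim Y(E_*)` with `E_*` a Cauchy sequence all of whose terms
lie in `M i`. -/
def completionBall (cone : ConeRel C) (M : ℕ → ObjectProperty C) (i : ℕ) :
    ObjectProperty (RMod C) :=
  fun F => ∃ E : ℕ ⥤ C, IsCauchy cone M E ∧ (∀ n, M i (E.obj n)) ∧ Nonempty (SeqColimit E F)

end Completion

section Shift

variable {S : Type u} [Category.{v} S] [Preadditive S] [HasShift S ℤ]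
  [∀ n : ℤ, (shiftFunctor S n).Additive]

/-- The adjunction homomorphism `Hom(Z, ΣX) ⟶ Hom(Σ⁻¹Z, X)`. -/
def homShift (Z X : S) : (Z ⟶ X⟦(1 : ℤ)⟧) →+ (Z⟦(-1 : ℤ)⟧ ⟶ X) where
  toFun φ := φ⟦(-1 : ℤ)⟧' ≫ (shiftFunctorCompIsoId S (1 : ℤ) (-1) (by norm_num)).hom.app X
  map_zero' := by simp
  map_add' φ ψ := by simp [Functor.map_add, Preadditive.add_comp]

lemma homShift_comp {Z W X : S} (k : W ⟶ Z) (φ : Z ⟶ X⟦(1 : ℤ)⟧) :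
    homShift W X (k ≫ φ) = k⟦(-1 : ℤ)⟧' ≫ homShift Z X φ := by
  simp [homShift]

end Shift

/-! ### Good metrics on a triangulated category, and the category `𝔖(S)` -/

section Triangulated

variable {S : Type u} [Category.{v} S] [Preadditive S] [HasZeroObject S] [HasShift S ℤ]
  [∀ n : ℤ, (shiftFunctor S n).Additive] [Pretriangulated S]

/-- A good metric on `S`: full subcategories `M i` containing `0`, closed under extensions
(`M i * M i ⊆ M i`), and with `Σ⁻¹ M (i+1) ∪ M (i+1) ∪ Σ M (i+1) ⊆ M i`. -/
structure IsGoodMetric (M : ℕ → ObjectProperty S) : Prop where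
  containsZero : ∀ i, (M i).ContainsZero
  extension : ∀ i, ∀ T ∈ distTriang S, M i T.obj₁ → M i T.obj₃ → M i T.obj₂
  shift_neg : ∀ i X, M (i + 1) X → M i (X⟦(-1 : ℤ)⟧)
  le : ∀ i X, M (i + 1) X → M i X
  shift_pos : ∀ i X, M (i + 1) X → M i (X⟦(1 : ℤ)⟧)

/-- `D` is the third object of a distinguished triangle `X ⟶ Y ⟶ D ⟶ ΣX` of `S`, with the
given first morphism `f`. -/
def coneRel : ConeRel S := fun X _ f D =>
  ∃ (g : _ ⟶ D) (h : D ⟶ X⟦(1 : ℤ)⟧), Triangle.mk f g h ∈ distTriang S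

/-- `𝔏(S)`, the completion of `S`. -/
abbrev 𝔏 (M : ℕ → ObjectProperty S) : ObjectProperty (RMod S) := completion coneRel M

/-- `ℒ_i ⊆ 𝔏(S)`. -/
abbrev ℒ (M : ℕ → ObjectProperty S) (i : ℕ) : ObjectProperty (RMod S) :=
  completionBall coneRel M i

/-- The modules `A` such that `Hom(Y(M i), A) = 0` for some `i`. -/
def compactlySupported (M : ℕ → ObjectProperty S) : ObjectProperty (RMod S) := fun A =>
  ∃ i : ℕ, ∀ X : S, M i X → ∀ f : (yonedaMod S).obj X ⟶ A, f = 0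

/-- `𝔖(S) = 𝔏(S) ∩ ⋃ᵢ Y(M i)^⊥`, as a full subcategory of `Mod-S`. -/
def 𝔖 (M : ℕ → ObjectProperty S) : ObjectProperty (RMod S) :=
  𝔏 M ⊓ compactlySupported M

/-- `𝒩_i = ℒ_i ∩ 𝔖(S)`, as a full subcategory of `𝔖(S)`. -/
def 𝒩 (M : ℕ → ObjectProperty S) (i : ℕ) : ObjectProperty (𝔖 M).FullSubcategory := fun F =>
  ℒ M i F.obj

variable (S) in
/-- The suspension `Σ` on `Mod-S`, `ΣF = F ∘ Σ⁻¹`; it extends the suspension of `S` along `Y`. -/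
def shiftMod : RMod S ⥤ RMod S where
  obj F := AdditiveFunctor.of ((shiftFunctor S (-1 : ℤ)).op ⋙ F.obj)
  map α := ObjectProperty.homMk (Functor.whiskerLeft (shiftFunctor S (-1 : ℤ)).op α.hom)

/-- The canonical map `Y(ΣX) ⟶ ΣY(X)`, given by `Hom(Z, ΣX) ≅ Hom(Σ⁻¹Z, X)`. -/
def yonedaShift (X : S) :
    (yonedaMod S).obj (X⟦(1 : ℤ)⟧) ⟶ (shiftMod S).obj ((yonedaMod S).obj X) :=
  ObjectProperty.homMk
    { app := fun Z => AddCommGrpCat.ofHom (homShift Z.unop X)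
      naturality := fun _ _ k => AddCommGrpCat.ext fun φ => homShift_comp k.unop φ }

/-- `a_* ⟶ b_* ⟶ c_* ⟶ Σa_*` is a Cauchy sequence of distinguished triangles of `S`. -/
structure IsCauchyTriangleSeq (M : ℕ → ObjectProperty S) {a b c : ℕ ⥤ S}
    (f : a ⟶ b) (g : b ⟶ c) (h : c ⟶ a ⋙ shiftFunctor S (1 : ℤ)) : Prop where
  cauchy₁ : IsCauchy coneRel M a
  cauchy₂ : IsCauchy coneRel M b
  cauchy₃ : IsCauchy coneRel M c
  distinguished : ∀ n, Triangle.mk (f.app n) (g.app n) (h.app n) ∈ distTriang S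

/-- `A ⟶ B ⟶ C ⟶ ΣA` in `Mod-S` is a strong triangle: the colimit of the image under `Y` of a
Cauchy sequence of distinguished triangles of `S`. -/
def IsStrongTriangle (M : ℕ → ObjectProperty S) {A B C : RMod S}
    (f : A ⟶ B) (g : B ⟶ C) (h : C ⟶ (shiftMod S).obj A) : Prop :=
  ∃ (a b c : ℕ ⥤ S) (f' : a ⟶ b) (g' : b ⟶ c) (h' : c ⟶ a ⋙ shiftFunctor S (1 : ℤ))
    (α : SeqColimit a A) (β : SeqColimit b B) (γ : SeqColimit c C),
    IsCauchyTriangleSeq M f' g' h' ∧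
    (∀ n, α.ι.app n ≫ f = (yonedaMod S).map (f'.app n) ≫ β.ι.app n) ∧
    (∀ n, β.ι.app n ≫ g = (yonedaMod S).map (g'.app n) ≫ γ.ι.app n) ∧
    (∀ n, γ.ι.app n ≫ h = (yonedaMod S).map (h'.app n) ≫ yonedaShift (a.obj n) ≫
      (shiftMod S).map (α.ι.app n))

/-- The relation "`X ⟶ Y ⟶ D` can be completed to a distinguished triangle" in `𝔖(S)ᵒᵖ`.
The distinguished triangles of `𝔖(S)` are the strong triangles whose three objects lie in `𝔖(S)`.
The suspension of the opposite category is `Σ⁻¹`, and (up to rotation and signs)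
`X ⟶ Y ⟶ D ⟶ Σ⁻¹X` is distinguished in `𝔖(S)ᵒᵖ` when `D ⟶ Y ⟶ X ⟶ ΣD` is distinguished
in `𝔖(S)`. -/
def coneRelOp (M : ℕ → ObjectProperty S) : ConeRel (𝔖 M).FullSubcategoryᵒᵖ := fun X Y f D =>
  ∃ (g : D.unop ⟶ Y.unop) (h : X.unop.obj ⟶ (shiftMod S).obj D.unop.obj),
    IsStrongTriangle M g.hom f.unop.hom h

/-- `𝔏(𝔖(S)ᵒᵖ)`, the completion of `𝔖(S)ᵒᵖ` with respect to the metric `𝒩_iᵒᵖ`. -/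
def 𝔏Op (M : ℕ → ObjectProperty S) : ObjectProperty (RMod (𝔖 M).FullSubcategoryᵒᵖ) :=
  completion (coneRelOp M) fun i => (𝒩 M i).op

/-- `ℒ̂_i ⊆ 𝔏(𝔖(S)ᵒᵖ)`: the analogue of `ℒ_i` for `𝔖(S)ᵒᵖ` and the metric `𝒩_iᵒᵖ`. -/
def ℒOp (M : ℕ → ObjectProperty S) (i : ℕ) : ObjectProperty (RMod (𝔖 M).FullSubcategoryᵒᵖ) :=
  completionBall (coneRelOp M) (fun i => (𝒩 M i).op) i

/-- The functor `Hom(N, -)` restricted to `𝔖(S)`, as an additive functor on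
`𝔖(S) = (𝔖(S)ᵒᵖ)ᵒᵖ`. -/
def yHatObj (M : ℕ → ObjectProperty S) (N : (RMod S)ᵒᵖ) : RMod (𝔖 M).FullSubcategoryᵒᵖ :=
  ⟨unopUnop (𝔖 M).FullSubcategory ⋙ (𝔖 M).ι ⋙ preadditiveCoyoneda.obj N, by
    have : (unopUnop (𝔖 M).FullSubcategory).Additive := ⟨rfl⟩
    have : ((𝔖 M).ι ⋙ preadditiveCoyoneda.obj N).Additive := inferInstance
    exact inferInstanceAs (Functor.Additive (_ ⋙ _))⟩

/-- The functor `Ŷ : (Mod-S)ᵒᵖ ⥤ Mod-(𝔖(S)ᵒᵖ)`, sending `N` to the restriction of `Hom(N, -)`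
to `𝔖(S)`. -/
def yHat (M : ℕ → ObjectProperty S) : (RMod S)ᵒᵖ ⥤ RMod (𝔖 M).FullSubcategoryᵒᵖ where
  obj N := yHatObj M N
  map α := ObjectProperty.homMk
    (Functor.whiskerLeft (unopUnop (𝔖 M).FullSubcategory)
      (Functor.whiskerLeft (𝔖 M).ι (preadditiveCoyoneda.map α)))

/-! ### Excellent metrics -/

/-- A map `f : a_* ⟶ b_*` of Cauchy sequences in `S` is of type `n` if, for every completion to a
Cauchy sequence of distinguished triangles `a_* ⟶ b_* ⟶ c_* ⟶ Σa_*`, one has `c_i ∈ M n` for all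
sufficiently large `i`. -/
def IsTypeSeq (M : ℕ → ObjectProperty S) (n : ℕ) {a b : ℕ ⥤ S} (f : a ⟶ b) : Prop :=
  ∀ (c : ℕ ⥤ S) (g : b ⟶ c) (h : c ⟶ a ⋙ shiftFunctor S (1 : ℤ)),
    IsCauchyTriangleSeq M f g h → ∃ N : ℕ, ∀ i, N ≤ i → M n (c.obj i)

/-- Let `A = colim Y(a_*)` and `B = colim Y(b_*)`. The morphism `F : A ⟶ B` is of type `n` with
respect to `(a_*, b_*)` if it is the colimit of a map of type `n` from a subsequence of `a_*` to a
subsequence of `b_*`. -/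
def IsOfType (M : ℕ → ObjectProperty S) (n : ℕ) {a b : ℕ ⥤ S} {A B : RMod S}
    (α : SeqColimit a A) (β : SeqColimit b B) (F : A ⟶ B) : Prop :=
  ∃ (φ ψ : ℕ → ℕ) (hφ : StrictMono φ) (hψ : StrictMono ψ) (f : subseq a hφ ⟶ subseq b hψ),
    (∀ i, α.ι.app (φ i) ≫ F = (yonedaMod S).map (f.app i) ≫ β.ι.app (ψ i)) ∧ IsTypeSeq M n f

/-- Excellent metrics. -/
structure IsExcellent (M : ℕ → ObjectProperty S) : Prop extends IsGoodMetric M where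
  /-- `S = ⋃ᵢ ^⊥(M i)` -/
  exists_leftOrthogonal : ∀ F : S, ∃ i, (M i).leftOrthogonal F
  /-- For every `m` there is `n > m` such that every `F ∈ S` lies in a distinguished triangle
  `E ⟶ F ⟶ D ⟶ ΣE` with `E ∈ ^⊥(M n)` and `D ∈ M m`. -/
  exists_triangle : ∀ m : ℕ, ∃ n : ℕ, m < n ∧ ∀ F : S, ∃ T ∈ distTriang S,
    T.obj₂ = F ∧ (M n).leftOrthogonal T.obj₁ ∧ M m T.obj₃
  /-- For every `m` there is `n > m` such that every `F ∈ S` admits a morphism `Y(F) ⟶ D` of type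
  `m` with respect to `(F, d_*)`, where `F` stands for the constant sequence, `d_*` is a Cauchy
  sequence with `D = colim Y(d_*)`, and `D ∈ 𝔖(S) ∩ (ℒ_n)^⊥`. -/
  exists_type : ∀ m : ℕ, ∃ n : ℕ, m < n ∧ ∀ F : S,
    ∃ (D : RMod S) (d : ℕ ⥤ S) (δ : SeqColimit d D) (ψ : (yonedaMod S).obj F ⟶ D),
      IsCauchy coneRel M d ∧ 𝔖 M D ∧ (ℒ M n).rightOrthogonal D ∧
      IsOfType M m (constSeqColimit F) δ ψ

end Triangulated

/-- The functor `F` restricts to an equivalence from the full subcategory `P` of its source to the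
full subcategory `Q` of its target. -/
def RestrictsToEquivalence {C : Type*} [Category* C] {D : Type*} [Category* D] (F : C ⥤ D)
    (P : ObjectProperty C) (Q : ObjectProperty D) : Prop :=
  ∃ h : ∀ X : P.FullSubcategory, Q ((P.ι ⋙ F).obj X), (Q.lift (P.ι ⋙ F) h).IsEquivalence

end MetricCompletion

end

/-!
The theorem rests on one estimate. Call a morphism of `S` `i`-close if its cone lies in `M i`
(`IsClose`), and extend the notion to maps `Y(X) ⟶ colim Y(c_*)` (`CloseTo`) and to maps between
objects of the completion with chosen Cauchy sequences (`MapClose`). By the octahedral axiom close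
morphisms compose and cancel, at the cost of one step in the index. Close maps look invertible to
two kinds of test objects:

* if `T` is left orthogonal to `M i` and `F` is `(i + 1)`-close, then `Hom(Y(T), F)` is bijective
  (`MapClose.exists_lift`, `MapClose.lift_unique`);
* if `H ∈ 𝔖(S)` is right orthogonal to `Y(M i)` and `F` is `(i + 1)`-close, then `Hom(F, H)` is
  bijective (`MapClose.exists_extend`, `MapClose.eq_zero_of_precomp`).

Condition (iii) of an excellent metric, extended from `S` to its completion, gives close maps from
`A ∈ 𝔏(S)` to objects `D_j` of `𝔖(S)`, orthogonal to a ball known in advance. By the second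
principle these organize into an inverse sequence, Cauchy in `𝔖(S)ᵒᵖ`, with
`Ŷ(A) = colim Hom(D_j, -)` (`IsExcellent.exists_isApprox`, `IsApprox.nonempty_seqColimit`); thus `Ŷ` maps the completion
of `S` to that of `𝔖(S)ᵒᵖ`. By condition (i) every object of `S` is left orthogonal to some ball,
so by the first principle `A` is the limit of the `D_j` in `Mod-S`; hence `Ŷ` is fully faithful on
`𝔏(S)`.

For essential surjectivity (`IsExcellent.exists_yHatObj_iso`), let `D_*` be Cauchy in `𝔖(S)ᵒᵖ`.
After passing to a subsequence, the `D_k` have representing sequences for which the transition maps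
are close. Condition (ii) gives objects `E_k` of `S`, close to `D_k` and left orthogonal to a ball.
By the first principle they lift along the inverse sequence to a Cauchy sequence `E_*`, and `D_*`
approximates `B = colim Y(E_*)`, so that `Ŷ(B)` is the colimit of the representables on `D_*`.

To pass between the Cauchy condition on `D_*`, which speaks of all strong triangles on the
transition maps, and closeness with respect to chosen sequences, one needs that maps in `𝔖(S)` have
strong triangles (`exists_triangleRep_of_map`) and that these are unique up to isomorphism
(`TriangleRep.nonempty_iso₁`, `TriangleRep.exists_iso₂`). The balls `ℒ l` are carried along by
starting the recursions at an index not below `l`.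
-/

noncomputable section

namespace MetricCompletion

/-! ### Sequential colimits of representable modules -/

section Modules

variable {C : Type u} [Category.{v} C] [Preadditive C]

lemma preservesColimitsOfShape_nat_forget :
    PreservesColimitsOfShape ℕ (forget AddCommGrpCat.{v}) := by
  have : IsFiltered (AsSmall.{v} ℕ) := IsFiltered.of_equivalence AsSmall.equiv
  exact preservesColimitsOfShape_of_equiv AsSmall.equiv.symm _

instance : (additiveFunctor Cᵒᵖ AddCommGrpCat.{v}).IsClosedUnderColimitsOfShape ℕ where
  colimitsOfShape_le := by
    rintro G ⟨p⟩
    refine ⟨fun {X Y f g} => ?_⟩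
    have hc := isColimitOfPreserves ((evaluation Cᵒᵖ AddCommGrpCat.{v}).obj X) p.isColimit
    refine hc.hom_ext fun n => ?_
    have : (p.diag.obj n).Additive := p.prop_diag_obj n
    have h (k : X ⟶ Y) := (p.ι.app n).naturality k
    dsimp at h ⊢
    rw [Preadditive.comp_add, ← h, ← h, ← h, Functor.map_add, Preadditive.add_comp]

/-- The Yoneda lemma: the map `Y(X) ⟶ F` classified by an element of `F(X)`. -/
def ofElem {X : C} {F : RMod C} (x : F.obj.obj (op X)) : (yonedaMod C).obj X ⟶ F :=
  ObjectProperty.homMk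
    { app := fun Z => AddCommGrpCat.ofHom
        { toFun := fun φ : Z.unop ⟶ X => F.obj.map φ.op x
          map_zero' := by
            have : F.obj.Additive := F.property
            change F.obj.map (0 : op X ⟶ Z) x = 0
            rw [Functor.map_zero]
            rfl
          map_add' := fun a b => by
            have : F.obj.Additive := F.property
            change F.obj.map (Quiver.Hom.op a + Quiver.Hom.op b) x = _
            rw [Functor.map_add]
            rfl }
      naturality := fun _ Z k => AddCommGrpCat.ext fun φ => by
        change F.obj.map (Quiver.Hom.op φ ≫ k) x = F.obj.map k (F.obj.map (Quiver.Hom.op φ) x)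
        simp }

/-- The element of `F(X)` classifying a map `Y(X) ⟶ F`. -/
def toElem {X : C} {F : RMod C} (φ : (yonedaMod C).obj X ⟶ F) : F.obj.obj (op X) :=
  φ.hom.app (op X) (𝟙 X)

lemma toElem_ofElem {X : C} {F : RMod C} (x : F.obj.obj (op X)) : toElem (ofElem x) = x := by
  change F.obj.map (𝟙 X).op x = x
  simp

lemma toElem_map_comp {X Z : C} {F : RMod C} (k : Z ⟶ X) (φ : (yonedaMod C).obj X ⟶ F) :
    toElem ((yonedaMod C).map k ≫ φ) = φ.hom.app (op Z) k := by
  change φ.hom.app (op Z) (𝟙 Z ≫ k) = _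
  rw [Category.id_comp]

lemma app_eq_map_toElem {X Z : C} {F : RMod C} (φ : (yonedaMod C).obj X ⟶ F) (k : Z ⟶ X) :
    φ.hom.app (op Z) k = F.obj.map k.op (toElem φ) := by
  have h := ConcreteCategory.congr_hom (φ.hom.naturality k.op) (𝟙 X)
  change φ.hom.app (op Z) (k ≫ 𝟙 X) = _ at h
  rw [Category.comp_id] at h
  exact h

lemma toElem_injective {X : C} {F : RMod C} {φ ψ : (yonedaMod C).obj X ⟶ F}
    (h : toElem φ = toElem ψ) : φ = ψ := by
  refine ObjectProperty.hom_ext _ (NatTrans.ext (funext fun Z => AddCommGrpCat.ext fun k => ?_))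
  change φ.hom.app (op Z.unop) k = ψ.hom.app (op Z.unop) k
  rw [app_eq_map_toElem φ k, app_eq_map_toElem ψ k, h]

lemma toElem_comp {X : C} {F G : RMod C} (φ : (yonedaMod C).obj X ⟶ F) (k : F ⟶ G) :
    toElem (φ ≫ k) = k.hom.app (op X) (toElem φ) := rfl

instance : (yonedaMod C).Additive where
  map_add {X Z f g} := toElem_injective (by
    change 𝟙 X ≫ (f + g) = 𝟙 X ≫ f + 𝟙 X ≫ g
    simp)

/-- A map of modules is invertible if it induces bijections on maps out of representables. -/
lemma isIso_of_bijective {F G : RMod C} (k : F ⟶ G)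
    (inj : ∀ (X : C) (φ : (yonedaMod C).obj X ⟶ F), φ ≫ k = 0 → φ = 0)
    (surj : ∀ (X : C) (φ : (yonedaMod C).obj X ⟶ G), ∃ ψ, ψ ≫ k = φ) : IsIso k := by
  have : IsIso k.hom := by
    rw [NatTrans.isIso_iff_isIso_app]
    intro X
    have : Function.Bijective (k.hom.app X) := by
      constructor
      · rw [injective_iff_map_eq_zero]
        intro x hx
        have h := inj X.unop (ofElem x) (toElem_injective (by
          rw [toElem_comp, toElem_ofElem]; exact hx))
        have h' := congrArg toElem h
        rw [toElem_ofElem] at h'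
        exact h'
      · intro y
        obtain ⟨ψ, hψ⟩ := surj X.unop (ofElem y)
        refine ⟨toElem ψ, ?_⟩
        have h := congrArg toElem hψ
        rw [toElem_comp, toElem_ofElem] at h
        exact h
    exact (ConcreteCategory.isIso_iff_bijective _).2 this
  have : IsIso ((AdditiveFunctor.forget _ _).map k) := this
  exact isIso_of_reflects_iso k (AdditiveFunctor.forget _ _)

/-- Maps of modules are equal if they agree on maps out of representables. -/
lemma hom_ext_yoneda {F G : RMod C} {k l : F ⟶ G}
    (h : ∀ (X : C) (φ : (yonedaMod C).obj X ⟶ F), φ ≫ k = φ ≫ l) : k = l := by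
  refine ObjectProperty.hom_ext _ (NatTrans.ext (funext fun Z => AddCommGrpCat.ext fun x => ?_))
  have h' := congrArg toElem (h Z.unop (ofElem x))
  rw [toElem_comp, toElem_comp, toElem_ofElem] at h'
  exact h'

namespace SeqColimit

variable {E : ℕ ⥤ C} {F : RMod C}

/-- The map `Y(X) ⟶ colim Y(E_*)` represented by a morphism `X ⟶ E_n`. -/
def germ (α : SeqColimit E F) {X : C} {n : ℕ} (g : X ⟶ E.obj n) : (yonedaMod C).obj X ⟶ F :=
  (yonedaMod C).map g ≫ α.ι.app n

lemma germ_id (α : SeqColimit E F) (n : ℕ) : α.germ (𝟙 (E.obj n)) = α.ι.app n := by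
  rw [germ, CategoryTheory.Functor.map_id]
  exact Category.id_comp (α.ι.app n)

lemma map_germ (α : SeqColimit E F) {X Z : C} {n : ℕ} (k : Z ⟶ X) (g : X ⟶ E.obj n) :
    (yonedaMod C).map k ≫ α.germ g = α.germ (k ≫ g) := by
  rw [germ, germ, Functor.map_comp, Category.assoc]

lemma map_germ_id (α : SeqColimit E F) {Z : C} {n : ℕ} (k : Z ⟶ E.obj n) :
    (yonedaMod C).map k ≫ α.germ (𝟙 (E.obj n)) = α.germ k := by
  rw [map_germ, Category.comp_id]

lemma germ_map (α : SeqColimit E F) {X : C} {m n : ℕ} (g : X ⟶ E.obj m) (h : m ⟶ n) :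
    α.germ (g ≫ E.map h) = α.germ g := by
  have w := α.ι.naturality h
  rw [germ, germ, Functor.map_comp, Category.assoc]
  exact congrArg (_ ≫ ·) (w.trans (Category.comp_id _))

lemma germ_sub (α : SeqColimit E F) {X : C} {n : ℕ} (g g' : X ⟶ E.obj n) :
    α.germ (g - g') = α.germ g - α.germ g' := by
  rw [germ, germ, germ, Functor.map_sub, Preadditive.sub_comp]

lemma germ_zero (α : SeqColimit E F) {X : C} {n : ℕ} : α.germ (0 : X ⟶ E.obj n) = 0 := by
  rw [germ, Functor.map_zero, zero_comp]

lemma nonempty_isColimit_forget (α : SeqColimit E F) (X : C) :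
    Nonempty (IsColimit (((AdditiveFunctor.forget Cᵒᵖ AddCommGrpCat.{v} ⋙
      (evaluation Cᵒᵖ AddCommGrpCat.{v}).obj (op X)) ⋙ forget AddCommGrpCat.{v}).mapCocone
        (Cocone.mk F α.ι))) := by
  have := preservesColimitsOfShape_nat_forget.{v}
  have : PreservesColimitsOfShape ℕ (AdditiveFunctor.forget Cᵒᵖ AddCommGrpCat.{v}) :=
    inferInstance
  exact ⟨isColimitOfPreserves _ α.isColimit⟩

lemma toElem_germ (α : SeqColimit E F) {X : C} {n : ℕ} (g : X ⟶ E.obj n) :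
    toElem (α.germ g) = (α.ι.app n).hom.app (op X) g :=
  toElem_map_comp g (α.ι.app n)

/-- Every map `Y(X) ⟶ colim Y(E_*)` is represented by a morphism `X ⟶ E_n`, with `n` as large
as desired. -/
lemma exists_germ_eq (α : SeqColimit E F) {X : C} (φ : (yonedaMod C).obj X ⟶ F) (N : ℕ) :
    ∃ (n : ℕ) (_ : N ≤ n) (g : X ⟶ E.obj n), α.germ g = φ := by
  obtain ⟨h⟩ := α.nonempty_isColimit_forget X
  obtain ⟨n, g, hg⟩ := Types.jointly_surjective_of_isColimit h (toElem φ)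
  refine ⟨max N n, le_max_left _ _, (show X ⟶ E.obj n from g) ≫
    E.map (homOfLE (le_max_right N n)), ?_⟩
  rw [germ_map]
  exact toElem_injective ((α.toElem_germ g).trans hg)

/-- A map `X ⟶ E_n` that vanishes in the colimit vanishes at a finite stage. -/
lemma exists_comp_map_eq_zero (α : SeqColimit E F) {X : C} {n : ℕ} (g : X ⟶ E.obj n)
    (hg : α.germ g = 0) : ∃ (m : ℕ) (h : n ≤ m), g ≫ E.map (homOfLE h) = 0 := by
  obtain ⟨hc⟩ := α.nonempty_isColimit_forget X
  have h0 : (α.ι.app n).hom.app (op X) g = (α.ι.app n).hom.app (op X) (0 : X ⟶ E.obj n) := by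
    rw [← toElem_germ, ← toElem_germ, hg, germ_zero]
  obtain ⟨m, i, j, h⟩ := (Types.FilteredColimit.isColimit_eq_iff _ hc).1 h0
  refine ⟨m, leOfHom i, ?_⟩
  change g ≫ E.map i = 0 ≫ E.map j at h
  rw [zero_comp] at h
  exact h

/-- Two representatives of the same map become equal at all large enough stages. -/
lemma exists_comp_map_eq (α : SeqColimit E F) {X : C} {n n' : ℕ} (g : X ⟶ E.obj n)
    (g' : X ⟶ E.obj n') (hg : α.germ g = α.germ g') (N : ℕ) :
    ∃ (m : ℕ) (_ : N ≤ m) (h : n ≤ m) (h' : n' ≤ m),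
      g ≫ E.map (homOfLE h) = g' ≫ E.map (homOfLE h') := by
  let p := max N (max n n')
  have hn : n ≤ p := by lia
  have hn' : n' ≤ p := by lia
  obtain ⟨m, hm, h⟩ := α.exists_comp_map_eq_zero
    (g ≫ E.map (homOfLE hn) - g' ≫ E.map (homOfLE hn'))
    (by rw [germ_sub, germ_map, germ_map, hg, sub_self])
  refine ⟨m, by lia, by lia, by lia, ?_⟩
  rw [Preadditive.sub_comp, Category.assoc, Category.assoc, ← E.map_comp, ← E.map_comp,
    sub_eq_zero] at h
  exact h

lemma hom_ext (α : SeqColimit E F) {G : RMod C} {k l : F ⟶ G} (N : ℕ)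
    (h : ∀ n, N ≤ n → α.germ (𝟙 (E.obj n)) ≫ k = α.germ (𝟙 (E.obj n)) ≫ l) : k = l := by
  refine hom_ext_yoneda fun X φ => ?_
  obtain ⟨n, hn, g, rfl⟩ := α.exists_germ_eq φ N
  rw [← α.map_germ_id g, Category.assoc, Category.assoc, h n hn]

/-- A map out of `colim Y(E_*)` is given by a compatible family on a tail of the sequence. -/
lemma exists_desc (α : SeqColimit E F) {G : RMod C} (N : ℕ)
    (φ : ∀ n, N ≤ n → ((yonedaMod C).obj (E.obj n) ⟶ G))
    (hφ : ∀ m n (hm : N ≤ m) (h : m ≤ n),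
      (yonedaMod C).map (E.map (homOfLE h)) ≫ φ n (hm.trans h) = φ m hm) :
    ∃ k : F ⟶ G, ∀ n (hn : N ≤ n), α.germ (𝟙 (E.obj n)) ≫ k = φ n hn := by
  let s : Cocone (E ⋙ yonedaMod C) := Cocone.mk G
    { app := fun n => (yonedaMod C).map (E.map (homOfLE (le_max_right N n))) ≫
        φ (max N n) (le_max_left _ _)
      naturality := fun m n h => by
        have hmn := leOfHom h
        dsimp
        rw [Category.comp_id, ← hφ (max N m) (max N n) (le_max_left _ _) (by lia),
          ← Category.assoc, ← Category.assoc, ← Functor.map_comp, ← Functor.map_comp,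
          ← Functor.map_comp, ← Functor.map_comp]
        rfl }
  refine ⟨α.isColimit.desc s, fun n hn => ?_⟩
  rw [germ_id]
  exact (α.isColimit.fac s n).trans (hφ n (max N n) hn (le_max_right N n))

/-- Any sequence has a colimit of representables. -/
def ofSeq (E : ℕ ⥤ C) : SeqColimit E (colimit (E ⋙ yonedaMod C)) where
  ι := (colimit.cocone (E ⋙ yonedaMod C)).ι
  isColimit := colimit.isColimit _

/-- A cocone on `Y(E_*)` is a colimit as soon as it is one when tested on maps out of
representables. -/
lemma nonempty_of_cocone (ι : E ⋙ yonedaMod C ⟶ (Functor.const ℕ).obj F)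
    (surj : ∀ (X : C) (φ : (yonedaMod C).obj X ⟶ F), ∃ (n : ℕ) (g : X ⟶ E.obj n),
      (yonedaMod C).map g ≫ ι.app n = φ)
    (inj : ∀ (X : C) (n : ℕ) (g : X ⟶ E.obj n), (yonedaMod C).map g ≫ ι.app n = 0 →
      ∃ (m : ℕ) (h : n ≤ m), g ≫ E.map (homOfLE h) = 0) :
    ∃ α : SeqColimit E F, α.ι = ι := by
  let β := ofSeq E
  have fac (n : ℕ) : β.ι.app n ≫ β.isColimit.desc (Cocone.mk F ι) = ι.app n :=
    β.isColimit.fac (Cocone.mk F ι) n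
  have : IsIso (β.isColimit.desc (Cocone.mk F ι)) := by
    refine isIso_of_bijective _ (fun X φ hφ => ?_) (fun X φ => ?_)
    · obtain ⟨n, -, g, rfl⟩ := β.exists_germ_eq φ 0
      rw [germ, Category.assoc, fac] at hφ
      obtain ⟨m, h, hm⟩ := inj X n g hφ
      rw [← β.germ_map g (homOfLE h), hm, germ_zero]
    · obtain ⟨n, g, rfl⟩ := surj X φ
      exact ⟨β.germ g, by rw [germ, Category.assoc, fac]⟩
  exact ⟨⟨ι, IsColimit.ofPointIso β.isColimit⟩, rfl⟩

/-- The colimit datum transported along an isomorphism of modules. -/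
def ofIso (α : SeqColimit E F) {G : RMod C} (e : F ≅ G) : SeqColimit E G where
  ι := α.ι ≫ (Functor.const ℕ).map e.hom
  isColimit := IsColimit.ofIsoColimit α.isColimit (Cocone.ext e (fun _ => rfl))

lemma ofIso_germ (α : SeqColimit E F) {G : RMod C} (e : F ≅ G) {X : C} {n : ℕ}
    (g : X ⟶ E.obj n) : (α.ofIso e).germ g = α.germ g ≫ e.hom :=
  (Category.assoc _ _ _).symm

/-- Two colimits of the same sequence are isomorphic. -/
def uniqueUpToIso (α : SeqColimit E F) {G : RMod C} (β : SeqColimit E G) : F ≅ G :=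
  α.isColimit.coconePointUniqueUpToIso β.isColimit

lemma exists_subseq (α : SeqColimit E F) {φ : ℕ → ℕ} (hφ : StrictMono φ) :
    ∃ β : SeqColimit (subseq E hφ) F, ∀ (X : C) (n : ℕ) (g : X ⟶ E.obj (φ n)),
      β.germ (n := n) g = α.germ g := by
  obtain ⟨β, hβ⟩ := nonempty_of_cocone (E := subseq E hφ) (F := F)
    { app := fun n => α.ι.app (φ n)
      naturality := fun m n h => α.ι.naturality (hφ.monotone.functor.map h) } (by
      intro X ψ
      obtain ⟨n, -, g, rfl⟩ := α.exists_germ_eq ψ 0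
      exact ⟨n, g ≫ E.map (homOfLE (hφ.id_le n)), α.germ_map g _⟩) (by
      intro X n g hg
      change X ⟶ E.obj (φ n) at g
      obtain ⟨m, h, hm⟩ := α.exists_comp_map_eq_zero g hg
      have h1 : m ≤ φ (max n m) := (le_max_right n m).trans (hφ.id_le _)
      refine ⟨max n m, le_max_left _ _, ?_⟩
      have : g ≫ E.map (homOfLE h) ≫ E.map (homOfLE h1) = 0 := by
        rw [← Category.assoc, hm, zero_comp]
      rw [← E.map_comp] at this
      exact this)
  refine ⟨β, fun X n g => ?_⟩
  change (yonedaMod C).map g ≫ β.ι.app n = _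
  rw [hβ]
  rfl

/-- The colimit of a subsequence. -/
def subseq (α : SeqColimit E F) {φ : ℕ → ℕ} (hφ : StrictMono φ) :
    SeqColimit (MetricCompletion.subseq E hφ) F :=
  (α.exists_subseq hφ).choose

lemma subseq_germ (α : SeqColimit E F) {φ : ℕ → ℕ} (hφ : StrictMono φ) {X : C} {n : ℕ}
    (g : X ⟶ E.obj (φ n)) : (α.subseq hφ).germ (n := n) g = α.germ g :=
  (α.exists_subseq hφ).choose_spec X n g

end SeqColimit

end Modules

/-! ### Close morphisms -/

section Close

variable {S : Type u} [Category.{v} S] [Preadditive S] [HasZeroObject S] [HasShift S ℤ]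
  [∀ n : ℤ, (shiftFunctor S n).Additive] [Pretriangulated S]
  {M : ℕ → ObjectProperty S}

namespace IsGoodMetric

lemma of_iso (hM : IsGoodMetric M) {i : ℕ} {X Y : S} (e : X ≅ Y) (hX : M i X) : M i Y := by
  obtain ⟨Z, hZ, hZ'⟩ := hM.containsZero i
  refine hM.extension i (Triangle.mk e.hom (0 : Y ⟶ Z) 0) ?_ hX hZ'
  rw [Triangle.distinguished_iff_of_isZero₃ _ hZ]
  change IsIso e.hom
  infer_instance

lemma antitone (hM : IsGoodMetric M) {i j : ℕ} (hij : i ≤ j) {X : S} (hX : M j X) : M i X := by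
  induction hij with
  | refl => exact hX
  | step _ ih => exact ih (hM.le _ _ hX)

lemma of_isZero (hM : IsGoodMetric M) (i : ℕ) {X : S} (hX : IsZero X) : M i X := by
  obtain ⟨Z, hZ, hZ'⟩ := hM.containsZero i
  exact hM.of_iso (hZ.iso hX) hZ'

end IsGoodMetric

/-- A morphism is `i`-close (to being invertible) if its cone lies in `M i`. For a good metric it
does not matter which cone is taken, and `(i + 1)`-closeness controls the shifts of the cone by one
step, as needed to cancel morphisms. -/
def IsClose (M : ℕ → ObjectProperty S) (i : ℕ) {X Y : S} (f : X ⟶ Y) : Prop :=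
  ∃ D, coneRel f D ∧ M i D

lemma exists_coneRel {X Y : S} (f : X ⟶ Y) : ∃ D, coneRel f D := by
  obtain ⟨D, g, h, hT⟩ := distinguished_cocone_triangle f
  exact ⟨D, g, h, hT⟩

lemma nonempty_iso_of_coneRel {X Y D D' : S} {f : X ⟶ Y} (h : coneRel f D) (h' : coneRel f D') :
    Nonempty (D ≅ D') := by
  obtain ⟨g, h, hT⟩ := h
  obtain ⟨g', h', hT'⟩ := h'
  exact ⟨Triangle.π₃.mapIso (isoTriangleOfIso₁₂ _ _ hT hT' (Iso.refl X) (Iso.refl Y)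
    ((Category.comp_id f).trans (Category.id_comp f).symm))⟩

namespace IsClose

variable {i j : ℕ} {X Y Z : S}

lemma of_distTriang {T : Triangle S} (hT : T ∈ distTriang S) (h : M i T.obj₃) :
    IsClose M i T.mor₁ :=
  ⟨_, ⟨_, _, hT⟩, h⟩

lemma of_coneRel (hM : IsGoodMetric M) {f : X ⟶ Y} (hf : IsClose M i f) {D : S}
    (hD : coneRel f D) : M i D := by
  obtain ⟨D', h, h'⟩ := hf
  obtain ⟨e⟩ := nonempty_iso_of_coneRel h hD
  exact hM.of_iso e h'

lemma mono (hM : IsGoodMetric M) {f : X ⟶ Y} (hf : IsClose M j f) (hij : i ≤ j) :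
    IsClose M i f := by
  obtain ⟨D, h, h'⟩ := hf
  exact ⟨D, h, hM.antitone hij h'⟩

lemma of_isIso (hM : IsGoodMetric M) (i : ℕ) (f : X ⟶ Y) [IsIso f] : IsClose M i f := by
  obtain ⟨D, hD⟩ := exists_coneRel f
  obtain ⟨g, h, hT⟩ := hD
  exact ⟨D, ⟨g, h, hT⟩, hM.of_isZero i ((Triangle.isZero₃_iff_isIso₁ _ hT).2
    (inferInstanceAs (IsIso f)))⟩

lemma target_mem (hM : IsGoodMetric M) {f : X ⟶ Y} (hf : IsClose M i f) (hX : M i X) :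
    M i Y := by
  obtain ⟨D, ⟨g, h, hT⟩, hD⟩ := hf
  exact hM.extension i _ hT hX hD

lemma source_mem (hM : IsGoodMetric M) {f : X ⟶ Y} (hf : IsClose M (i + 1) f) (hY : M i Y) :
    M i X := by
  obtain ⟨D, ⟨g, h, hT⟩, hD⟩ := hf
  exact hM.extension i _ (inv_rot_of_distTriang _ hT) (hM.shift_neg _ _ hD) hY

lemma exists_lift {f : X ⟶ Y} (hf : IsClose M i f) {T : S} (hT : (M i).leftOrthogonal T)
    (u : T ⟶ Y) : ∃ w : T ⟶ X, w ≫ f = u := by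
  obtain ⟨D, ⟨g, h, hd⟩, hD⟩ := hf
  obtain ⟨w, hw⟩ := Triangle.coyoneda_exact₂ _ hd u (hT (u ≫ g) hD)
  exact ⟨w, hw.symm⟩

lemma lift_unique (hM : IsGoodMetric M) {f : X ⟶ Y} (hf : IsClose M (i + 1) f) {T : S}
    (hT : (M i).leftOrthogonal T) (u : T ⟶ X) (hu : u ≫ f = 0) : u = 0 := by
  obtain ⟨D, ⟨g, h, hd⟩, hD⟩ := hf
  obtain ⟨w, hw⟩ := Triangle.coyoneda_exact₂ _ (inv_rot_of_distTriang _ hd) u hu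
  rw [hw, hT w (hM.shift_neg _ _ hD)]
  exact zero_comp

section Octahedral

variable [IsTriangulated S]

lemma comp (hM : IsGoodMetric M) {f : X ⟶ Y} {g : Y ⟶ Z} (hf : IsClose M i f)
    (hg : IsClose M i g) : IsClose M i (f ≫ g) := by
  obtain ⟨D, ⟨_, _, hT⟩, hD⟩ := hf
  obtain ⟨D', ⟨_, _, hT'⟩, hD'⟩ := hg
  obtain ⟨D'', v, w, hT''⟩ := exists_coneRel (f ≫ g)
  exact ⟨D'', ⟨v, w, hT''⟩,
    hM.extension i _ (Triangulated.someOctahedron rfl hT hT' hT'').mem hD hD'⟩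

lemma cancel_left (hM : IsGoodMetric M) {f : X ⟶ Y} {g : Y ⟶ Z} (hf : IsClose M (i + 1) f)
    (hfg : IsClose M i (f ≫ g)) : IsClose M i g := by
  obtain ⟨D, ⟨_, _, hT⟩, hD⟩ := hf
  obtain ⟨D', v, w, hT'⟩ := exists_coneRel g
  obtain ⟨D'', ⟨_, _, hT''⟩, hD''⟩ := hfg
  exact ⟨D', ⟨v, w, hT'⟩, hM.extension i _
    (rot_of_distTriang _ (Triangulated.someOctahedron rfl hT hT' hT'').mem) hD''
    (hM.shift_pos _ _ hD)⟩

lemma cancel_right (hM : IsGoodMetric M) {f : X ⟶ Y} {g : Y ⟶ Z} (hg : IsClose M (i + 1) g)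
    (hfg : IsClose M i (f ≫ g)) : IsClose M i f := by
  obtain ⟨D, v, w, hT⟩ := exists_coneRel f
  obtain ⟨D', ⟨_, _, hT'⟩, hD'⟩ := hg
  obtain ⟨D'', ⟨_, _, hT''⟩, hD''⟩ := hfg
  exact ⟨D, ⟨v, w, hT⟩, hM.extension i _
    (inv_rot_of_distTriang _ (Triangulated.someOctahedron rfl hT hT' hT'').mem)
    (hM.shift_neg _ _ hD') hD''⟩

lemma map_shift_neg_one (hM : IsGoodMetric M) {f : X ⟶ Y} (hf : IsClose M (i + 1) f) :
    IsClose M i (f⟦(-1 : ℤ)⟧') := by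
  obtain ⟨D, ⟨g, h, hT⟩, hD⟩ := hf
  have h1 : IsClose M i ((Int.negOnePow (-1)) • f⟦(-1 : ℤ)⟧') :=
    of_distTriang (Triangle.shift_distinguished _ hT (-1)) (hM.shift_neg _ _ hD)
  rw [Int.negOnePow_neg, Int.negOnePow_one, Units.neg_smul, one_smul] at h1
  have : IsIso (-𝟙 (Y⟦(-1 : ℤ)⟧)) := ⟨-𝟙 _, by simp, by simp⟩
  simpa using h1.comp hM (of_isIso hM i (-𝟙 (Y⟦(-1 : ℤ)⟧)))

end Octahedral

end IsClose

/-! ### Cauchy sequences -/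

lemma IsGoodMetric.isCauchy_iff (hM : IsGoodMetric M) (E : ℕ ⥤ S) :
    IsCauchy coneRel M E ↔ ∀ i : ℕ, ∃ N : ℕ, ∀ (m n : ℕ) (h : m ≤ n), N ≤ m →
      IsClose M i (E.map (homOfLE h)) := by
  refine forall_congr' fun i => exists_congr fun N => ?_
  constructor
  · intro hE m n h hm
    obtain rfl | h' := h.eq_or_lt
    · have : E.map (homOfLE h) = 𝟙 _ := E.map_id m
      rw [this]
      exact IsClose.of_isIso hM i _
    · obtain ⟨D, hD⟩ := exists_coneRel (E.map (homOfLE h))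
      exact ⟨D, hD, hE m n h' hm D hD⟩
  · intro hE m n h hm D hD
    exact (hE m n h.le hm).of_coneRel hM hD

lemma IsGoodMetric.exists_isClose (hM : IsGoodMetric M) {E : ℕ ⥤ S}
    (hE : IsCauchy coneRel M E) (i : ℕ) : ∃ N : ℕ, ∀ (m n : ℕ) (h : m ≤ n), N ≤ m →
      IsClose M i (E.map (homOfLE h)) :=
  (hM.isCauchy_iff E).1 hE i

lemma IsGoodMetric.isCauchy_of_succ [IsTriangulated S] (hM : IsGoodMetric M) {E : ℕ ⥤ S}
    (hE : ∀ i, ∃ N, ∀ n, N ≤ n → IsClose M i (E.map (homOfLE (Nat.le_succ n)))) :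
    IsCauchy coneRel M E := by
  rw [hM.isCauchy_iff]
  intro i
  obtain ⟨N, hN⟩ := hE i
  refine ⟨N, fun m n h hm => ?_⟩
  induction n, h using Nat.le_induction with
  | base => exact (E.map_id m) ▸ IsClose.of_isIso hM i (𝟙 _)
  | succ n h ih =>
    have : E.map (homOfLE (h.trans n.le_succ)) = E.map (homOfLE h) ≫ E.map (homOfLE n.le_succ) := by
      rw [← E.map_comp]
      rfl
    rw [this]
    exact ih.comp hM (hN n (by lia))

lemma IsGoodMetric.isCauchy_subseq (hM : IsGoodMetric M) {E : ℕ ⥤ S}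
    (hE : IsCauchy coneRel M E) {φ : ℕ → ℕ} (hφ : StrictMono φ) :
    IsCauchy coneRel M (subseq E hφ) := by
  rw [hM.isCauchy_iff]
  intro i
  obtain ⟨N, hN⟩ := hM.exists_isClose hE i
  exact ⟨N, fun m n h hm => hN (φ m) (φ n) (hφ.monotone h) (hm.trans (hφ.id_le m))⟩

lemma IsGoodMetric.isCauchy_const (hM : IsGoodMetric M) (X : S) :
    IsCauchy coneRel M ((Functor.const ℕ).obj X) := by
  rw [hM.isCauchy_iff]
  exact fun i => ⟨0, fun m n h _ => IsClose.of_isIso hM i (𝟙 X)⟩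

lemma IsGoodMetric.isCauchy_shift_neg_one [IsTriangulated S] (hM : IsGoodMetric M) {E : ℕ ⥤ S}
    (hE : IsCauchy coneRel M E) : IsCauchy coneRel M (E ⋙ shiftFunctor S (-1 : ℤ)) := by
  rw [hM.isCauchy_iff]
  intro i
  obtain ⟨N, hN⟩ := hM.exists_isClose hE (i + 1)
  exact ⟨N, fun m n h hm => (hN m n h hm).map_shift_neg_one hM⟩

/-! ### Completing maps of Cauchy sequences to Cauchy sequences of triangles -/

/-- A weak form of the `3 × 3` lemma: a commutative square extends to a morphism of given
triangles whose third component is close when the sides of the square are. The component is the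
composite of two comparison maps through a cone of the diagonal. -/
lemma exists_close_third [IsTriangulated S] (hM : IsGoodMetric M) {X Y D X' Y' D' : S}
    {f : X ⟶ Y} {g : Y ⟶ D} {h : D ⟶ X⟦(1 : ℤ)⟧} (hT : Triangle.mk f g h ∈ distTriang S)
    {f' : X' ⟶ Y'} {g' : Y' ⟶ D'} {h' : D' ⟶ X'⟦(1 : ℤ)⟧}
    (hT' : Triangle.mk f' g' h' ∈ distTriang S)
    (a : X ⟶ X') (b : Y ⟶ Y') (comm : f ≫ b = a ≫ f') :
    ∃ c : D ⟶ D', g ≫ c = b ≫ g' ∧ h ≫ a⟦(1 : ℤ)⟧' = c ≫ h' ∧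
      ∀ i, IsClose M (i + 1) a → IsClose M i b → IsClose M i c := by
  obtain ⟨P, p, p', hP⟩ := distinguished_cocone_triangle a
  obtain ⟨Q, q, q', hQ⟩ := distinguished_cocone_triangle b
  obtain ⟨E, e, e', hE⟩ := distinguished_cocone_triangle (f ≫ b)
  have o₁ := Triangulated.someOctahedron rfl hT hQ hE
  have o₂ := Triangulated.someOctahedron comm.symm hP hT' hE
  refine ⟨o₁.m₁ ≫ o₂.m₃, ?_, ?_, fun i ha hb => ?_⟩
  · rw [← Category.assoc, o₁.comm₁, Category.assoc, o₂.comm₃]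
  · rw [Category.assoc, ← o₂.comm₄, ← Category.assoc, o₁.comm₂]
  · refine IsClose.comp hM ⟨Q, ⟨_, _, o₁.mem⟩, hb.of_coneRel hM ⟨_, _, hQ⟩⟩
      ⟨_, ⟨_, _, rot_of_distTriang _ o₂.mem⟩, hM.shift_pos _ _ (ha.of_coneRel hM ⟨_, _, hP⟩)⟩

/-- Every map of Cauchy sequences can be completed to a Cauchy sequence of triangles. -/
lemma exists_isCauchyTriangleSeq [IsTriangulated S] (hM : IsGoodMetric M) {a b : ℕ ⥤ S}
    (f : a ⟶ b) (ha : IsCauchy coneRel M a) (hb : IsCauchy coneRel M b) :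
    ∃ (c : ℕ ⥤ S) (g : b ⟶ c) (h : c ⟶ a ⋙ shiftFunctor S (1 : ℤ)),
      IsCauchyTriangleSeq M f g h := by
  choose D g h hT using fun n => distinguished_cocone_triangle (f.app n)
  choose t ht₁ ht₂ ht₃ using fun n => exists_close_third hM (hT n) (hT (n + 1))
    (a.map (homOfLE n.le_succ)) (b.map (homOfLE n.le_succ)) (f.naturality _).symm
  refine ⟨Functor.ofSequence t, NatTrans.ofSequence (G := Functor.ofSequence t) g fun n => ?_,
    NatTrans.ofSequence (F := Functor.ofSequence t)
      (G := a ⋙ shiftFunctor S (1 : ℤ)) h fun n => ?_, ha, hb, hM.isCauchy_of_succ fun i => ?_, hT⟩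
  · rw [Functor.ofSequence_map_homOfLE_succ]
    exact (ht₁ n).symm
  · rw [Functor.ofSequence_map_homOfLE_succ]
    exact (ht₂ n).symm
  · obtain ⟨N, hN⟩ := hM.exists_isClose ha (i + 1)
    obtain ⟨N', hN'⟩ := hM.exists_isClose hb i
    refine ⟨max N N', fun n hn => ?_⟩
    rw [Functor.ofSequence_map_homOfLE_succ]
    exact ht₃ n i (hN _ _ _ (by lia)) (hN' _ _ _ (by lia))

/-- Every map of Cauchy sequences is the second map of a Cauchy sequence of triangles. -/
lemma exists_isCauchyTriangleSeq_of_second [IsTriangulated S] (hM : IsGoodMetric M) {b c : ℕ ⥤ S}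
    (g : b ⟶ c) (hb : IsCauchy coneRel M b) (hc : IsCauchy coneRel M c) :
    ∃ (a : ℕ ⥤ S) (f : a ⟶ b) (h : c ⟶ a ⋙ shiftFunctor S (1 : ℤ)),
      IsCauchyTriangleSeq M f g h := by
  obtain ⟨e, p, q, hT⟩ := exists_isCauchyTriangleSeq hM g hb hc
  let T (n : ℕ) : Triangle S := Triangle.mk (g.app n) (p.app n) (q.app n)
  let φ {m n : ℕ} (k : m ⟶ n) : T m ⟶ T n := Triangle.homMk _ _ (b.map k) (c.map k) (e.map k)
    (g.naturality k).symm (p.naturality k).symm (q.naturality k).symm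
  exact ⟨e ⋙ shiftFunctor S (-1 : ℤ),
    { app := fun n => (T n).invRotate.mor₁
      naturality := fun m n k => (((invRotate S).map (φ k)).comm₁).symm },
    { app := fun n => (T n).invRotate.mor₃
      naturality := fun m n k => (((invRotate S).map (φ k)).comm₃).symm },
    hM.isCauchy_shift_neg_one hT.cauchy₃, hb, hc,
    fun n => inv_rot_of_distTriang _ (hT.distinguished n)⟩

/-- Every map `c_* ⟶ Σa_*` of Cauchy sequences is the third map of a Cauchy sequence of
triangles. -/
lemma exists_isCauchyTriangleSeq_of_third [IsTriangulated S] (hM : IsGoodMetric M) {a c : ℕ ⥤ S}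
    (h : c ⟶ a ⋙ shiftFunctor S (1 : ℤ)) (ha : IsCauchy coneRel M a)
    (hc : IsCauchy coneRel M c) :
    ∃ (b : ℕ ⥤ S) (f : a ⟶ b) (g : b ⟶ c), IsCauchyTriangleSeq M f g h := by
  let u : c ⋙ shiftFunctor S (-1 : ℤ) ⟶ a :=
    { app := fun n => -(h.app n)⟦(-1 : ℤ)⟧' ≫ (shiftShiftNeg (a.obj n) (1 : ℤ)).hom
      naturality := fun m n k => by
        have h₁ : (c.map k)⟦(-1 : ℤ)⟧' ≫ (h.app n)⟦(-1 : ℤ)⟧' =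
            (h.app m)⟦(-1 : ℤ)⟧' ≫ (a.map k)⟦(1 : ℤ)⟧'⟦(-1 : ℤ)⟧' := by
          rw [← Functor.map_comp, ← Functor.map_comp]
          exact congrArg (fun t => t⟦(-1 : ℤ)⟧') (h.naturality k)
        have h₂ : (a.map k)⟦(1 : ℤ)⟧'⟦(-1 : ℤ)⟧' ≫ (shiftShiftNeg (a.obj n) (1 : ℤ)).hom =
            (shiftShiftNeg (a.obj m) (1 : ℤ)).hom ≫ a.map k :=
          (shiftEquiv S (1 : ℤ)).unitIso.inv.naturality (a.map k)
        change (c.map k)⟦(-1 : ℤ)⟧' ≫ (-(h.app n)⟦(-1 : ℤ)⟧' ≫ _) = (-_ ≫ _) ≫ a.map k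
        rw [Preadditive.neg_comp, Preadditive.comp_neg, Category.assoc, ← h₂,
          ← Category.assoc, ← Category.assoc, h₁] }
  obtain ⟨b, f, w, hT⟩ := exists_isCauchyTriangleSeq hM u (hM.isCauchy_shift_neg_one hc) ha
  let w' (n : ℕ) : b.obj n ⟶ (c.obj n)⟦(-1 : ℤ)⟧⟦(1 : ℤ)⟧ := w.app n
  refine ⟨b, f,
    { app := fun n => w' n ≫ (shiftNegShift (c.obj n) (1 : ℤ)).hom
      naturality := fun m n k => ?_ }, ha, hT.cauchy₃, hc, fun n => ?_⟩
  · have h₁ : b.map k ≫ w' n = w' m ≫ (c.map k)⟦(-1 : ℤ)⟧'⟦(1 : ℤ)⟧' := w.naturality k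
    have h₂ : (c.map k)⟦(-1 : ℤ)⟧'⟦(1 : ℤ)⟧' ≫ (shiftNegShift (c.obj n) (1 : ℤ)).hom =
        (shiftNegShift (c.obj m) (1 : ℤ)).hom ≫ c.map k :=
      (shiftEquiv S (1 : ℤ)).counitIso.hom.naturality (c.map k)
    rw [← Category.assoc, h₁, Category.assoc, h₂, Category.assoc]
  · refine isomorphic_distinguished _ (rot_of_distTriang _ ?_) _
      ((triangleRotation S).counitIso.app _).symm
    have e : (w' n ≫ (shiftNegShift (c.obj n) (1 : ℤ)).hom) ≫
        (shiftNegShift (c.obj n) (1 : ℤ)).inv = w' n := by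
      rw [Category.assoc, Iso.hom_inv_id, Category.comp_id]
    have hd : Triangle.mk (u.app n) (f.app n) (w' n) ∈ distTriang S := hT.distinguished n
    rw [← e] at hd
    exact hd

end Close

/-! ### Close maps between objects of the completion -/

section CloseMaps

variable {S : Type u} [Category.{v} S] [Preadditive S] [HasZeroObject S] [HasShift S ℤ]
  [∀ n : ℤ, (shiftFunctor S n).Additive] [Pretriangulated S]
  {M : ℕ → ObjectProperty S}

/-- A map `Y(X) ⟶ C = colim Y(c_*)` is `i`-close if all its representatives `X ⟶ c_p` with `p`
large are `i`-close. -/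
def CloseTo (M : ℕ → ObjectProperty S) (i : ℕ) {c : ℕ ⥤ S} {C : RMod S} (γ : SeqColimit c C)
    {X : S} (φ : (yonedaMod S).obj X ⟶ C) : Prop :=
  ∃ N, ∀ p, N ≤ p → ∀ g : X ⟶ c.obj p, γ.germ g = φ → IsClose M i g

/-- A map `A = colim Y(a_*) ⟶ B = colim Y(b_*)` is `i`-close if its restrictions to `Y(a_n)` are
so for all large `n`. The notion depends on the chosen sequences. -/
def MapClose (M : ℕ → ObjectProperty S) (i : ℕ) {a b : ℕ ⥤ S} {A B : RMod S}
    (α : SeqColimit a A) (β : SeqColimit b B) (F : A ⟶ B) : Prop :=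
  ∃ N, ∀ n, N ≤ n → CloseTo M i β (α.germ (𝟙 (a.obj n)) ≫ F)

/-- The module `H` is right orthogonal to `Y(M i)`. -/
def KillsBall (M : ℕ → ObjectProperty S) (i : ℕ) (H : RMod S) : Prop :=
  ∀ X : S, M i X → ∀ f : (yonedaMod S).obj X ⟶ H, f = 0

lemma KillsBall.mono (hM : IsGoodMetric M) {i j : ℕ} {H : RMod S} (hH : KillsBall M i H)
    (hij : i ≤ j) : KillsBall M j H :=
  fun X hX f => hH X (hM.antitone hij hX) f

namespace CloseTo

variable {i : ℕ} {c : ℕ ⥤ S} {C : RMod S} {γ : SeqColimit c C} {X X' : S}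
  {φ : (yonedaMod S).obj X ⟶ C}

lemma exists_germ_eq (h : CloseTo M i γ φ) (N : ℕ) :
    ∃ (p : ℕ) (_ : N ≤ p) (g : X ⟶ c.obj p), γ.germ g = φ ∧ IsClose M i g := by
  obtain ⟨N', hN'⟩ := h
  obtain ⟨p, hp, g, hg⟩ := γ.exists_germ_eq φ (max N N')
  exact ⟨p, by lia, g, hg, hN' p (by lia) g hg⟩

lemma mono (hM : IsGoodMetric M) {j : ℕ} (hij : i ≤ j) (h : CloseTo M j γ φ) :
    CloseTo M i γ φ := by
  obtain ⟨N, hN⟩ := h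
  exact ⟨N, fun p hp g hg => (hN p hp g hg).mono hM hij⟩

lemma exists_lift (h : CloseTo M i γ φ) {T : S} (hT : (M i).leftOrthogonal T)
    (χ : (yonedaMod S).obj T ⟶ C) : ∃ w : T ⟶ X, (yonedaMod S).map w ≫ φ = χ := by
  obtain ⟨q, -, u, rfl⟩ := γ.exists_germ_eq χ 0
  obtain ⟨N, hN⟩ := h
  obtain ⟨p, hp, g, rfl⟩ := γ.exists_germ_eq φ (max q N)
  obtain ⟨w, hw⟩ := (hN p (by lia) g rfl).exists_lift hT
    (u ≫ c.map (homOfLE (show q ≤ p by lia)))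
  exact ⟨w, by rw [SeqColimit.map_germ, hw, SeqColimit.germ_map]⟩

lemma lift_unique (hM : IsGoodMetric M) (h : CloseTo M (i + 1) γ φ) {T : S}
    (hT : (M i).leftOrthogonal T) (w : T ⟶ X) (hw : (yonedaMod S).map w ≫ φ = 0) : w = 0 := by
  obtain ⟨N, hN⟩ := h
  obtain ⟨p, hp, g, rfl⟩ := γ.exists_germ_eq φ N
  rw [SeqColimit.map_germ] at hw
  obtain ⟨m, hm, h0⟩ := γ.exists_comp_map_eq_zero _ hw
  rw [Category.assoc] at h0
  exact (hN m (by lia) (g ≫ c.map (homOfLE hm)) (γ.germ_map g _)).lift_unique hM hT w h0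

section Octahedral

variable [IsTriangulated S]

/-- For a Cauchy sequence, one late close representative suffices. -/
lemma of_frequently (hM : IsGoodMetric M) (hc : IsCauchy coneRel M c)
    (h : ∀ N, ∃ p, N ≤ p ∧ ∃ g : X ⟶ c.obj p, γ.germ g = φ ∧ IsClose M i g) :
    CloseTo M i γ φ := by
  obtain ⟨N, hN⟩ := hM.exists_isClose hc (i + 1)
  obtain ⟨p, hp, g, rfl, hg⟩ := h N
  refine ⟨N, fun p' hp' g' hg' => ?_⟩
  obtain ⟨m, -, hm, hm', e⟩ := γ.exists_comp_map_eq g g' hg'.symm 0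
  refine IsClose.cancel_right hM (hN p' m hm' hp') ?_
  rw [← e]
  exact hg.comp hM ((hN p m hm hp).mono hM (Nat.le_succ i))

lemma precomp (hM : IsGoodMetric M) (hc : IsCauchy coneRel M c) (h : CloseTo M i γ φ)
    {f : X' ⟶ X} (hf : IsClose M i f) : CloseTo M i γ ((yonedaMod S).map f ≫ φ) := by
  refine of_frequently hM hc fun N => ?_
  obtain ⟨p, hp, g, rfl, hg⟩ := h.exists_germ_eq N
  exact ⟨p, hp, f ≫ g, (γ.map_germ f g).symm, hf.comp hM hg⟩

lemma cancel (hM : IsGoodMetric M) {f : X' ⟶ X} (hf : IsClose M (i + 1) f)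
    (h : CloseTo M i γ ((yonedaMod S).map f ≫ φ)) : CloseTo M i γ φ := by
  obtain ⟨N, hN⟩ := h
  exact ⟨N, fun p hp g hg => hf.cancel_left hM
    (hN p hp (f ≫ g) (by rw [← hg, SeqColimit.map_germ]))⟩

lemma isClose (hM : IsGoodMetric M) {f : X' ⟶ X} (hφ : CloseTo M (i + 1) γ φ)
    (h : CloseTo M i γ ((yonedaMod S).map f ≫ φ)) : IsClose M i f := by
  obtain ⟨N, hN⟩ := h
  obtain ⟨p, hp, g, rfl, hg⟩ := hφ.exists_germ_eq N
  exact hg.cancel_right hM (hN p hp (f ≫ g) (γ.map_germ f g).symm)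

end Octahedral

end CloseTo

lemma exists_closeTo_germ_id [IsTriangulated S] (hM : IsGoodMetric M) {c : ℕ ⥤ S} {C : RMod S}
    (γ : SeqColimit c C) (hc : IsCauchy coneRel M c) (i : ℕ) :
    ∃ N, ∀ n, N ≤ n → CloseTo M i γ (γ.germ (𝟙 (c.obj n))) := by
  obtain ⟨N, hN⟩ := hM.exists_isClose hc i
  refine ⟨N, fun n hn => CloseTo.of_frequently hM hc fun N' =>
    ⟨max n N', le_max_right _ _, c.map (homOfLE (le_max_left n N')), ?_, hN _ _ _ hn⟩⟩
  rw [← γ.germ_map (𝟙 _) (homOfLE (le_max_left n N')), Category.id_comp]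

section Orthogonal

variable {i : ℕ} {h : ℕ ⥤ S} {H : RMod S}

lemma IsClose.eq_zero_of_precomp (η : SeqColimit h H) (hH : KillsBall M i H) {X Z : S}
    {f : X ⟶ Z} (hf : IsClose M i f) (φ : (yonedaMod S).obj Z ⟶ H)
    (hφ : (yonedaMod S).map f ≫ φ = 0) : φ = 0 := by
  obtain ⟨D, ⟨g, k, hT⟩, hD⟩ := hf
  obtain ⟨n, -, u, rfl⟩ := η.exists_germ_eq φ 0
  rw [SeqColimit.map_germ] at hφ
  obtain ⟨m, hm, h0⟩ := η.exists_comp_map_eq_zero _ hφ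
  rw [Category.assoc] at h0
  obtain ⟨w, hw⟩ : ∃ w : D ⟶ h.obj m, u ≫ h.map (homOfLE hm) = g ≫ w :=
    Triangle.yoneda_exact₂ _ hT _ h0
  rw [← η.germ_map u (homOfLE hm), hw, ← η.map_germ, hH D hD (η.germ w), comp_zero]

lemma IsClose.exists_extend (hM : IsGoodMetric M) (η : SeqColimit h H) (hH : KillsBall M i H)
    {X Z : S} {f : X ⟶ Z} (hf : IsClose M (i + 1) f) (φ : (yonedaMod S).obj X ⟶ H) :
    ∃ ψ, (yonedaMod S).map f ≫ ψ = φ := by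
  obtain ⟨D, ⟨g, k, hT⟩, hD⟩ := hf
  obtain ⟨n, -, u, rfl⟩ := η.exists_germ_eq φ 0
  obtain ⟨r, hr⟩ : ∃ r : D⟦(-1 : ℤ)⟧ ⟶ X, ∀ (W : S) (u : X ⟶ W), r ≫ u = 0 → ∃ w, u = f ≫ w :=
    ⟨_, fun W u hu => Triangle.yoneda_exact₂ _ (inv_rot_of_distTriang _ hT) u hu⟩
  have h0 := hH _ (hM.shift_neg _ _ hD) (η.germ (r ≫ u))
  obtain ⟨m, hm, h0⟩ := η.exists_comp_map_eq_zero _ h0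
  rw [Category.assoc] at h0
  obtain ⟨w, hw⟩ := hr _ _ h0
  exact ⟨η.germ w, by rw [SeqColimit.map_germ, ← hw, SeqColimit.germ_map]⟩

variable {c : ℕ ⥤ S} {C : RMod S} {γ : SeqColimit c C} {X : S} {φ : (yonedaMod S).obj X ⟶ C}

lemma CloseTo.eq_zero_of_precomp (hM : IsGoodMetric M) (hc : IsCauchy coneRel M c)
    (η : SeqColimit h H) (hH : KillsBall M i H)
    (hφ : CloseTo M i γ φ) (k : C ⟶ H) (hk : φ ≫ k = 0) : k = 0 := by
  obtain ⟨N, hN⟩ := hM.exists_isClose hc i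
  obtain ⟨p, hp, g, rfl, hg⟩ := hφ.exists_germ_eq N
  rw [← γ.map_germ_id, Category.assoc] at hk
  have h0 := hg.eq_zero_of_precomp η hH _ hk
  refine γ.hom_ext p fun n hn => ?_
  rw [comp_zero]
  refine (hN p n hn hp).eq_zero_of_precomp η hH _ ?_
  rw [← Category.assoc, γ.map_germ_id, ← h0, ← γ.germ_map (𝟙 _) (homOfLE hn), Category.id_comp]

lemma CloseTo.exists_extend (hM : IsGoodMetric M) (hc : IsCauchy coneRel M c)
    (η : SeqColimit h H) (hH : KillsBall M i H)
    (hφ : CloseTo M (i + 1) γ φ) (l : (yonedaMod S).obj X ⟶ H) : ∃ k : C ⟶ H, φ ≫ k = l := by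
  obtain ⟨N, hN⟩ := hM.exists_isClose hc (i + 1)
  obtain ⟨p, hp, g, rfl, hg⟩ := hφ.exists_germ_eq N
  obtain ⟨l₀, rfl⟩ := hg.exists_extend hM η hH l
  choose ψ hψ using fun n (hn : p ≤ n) => (hN p n hn hp).exists_extend hM η hH l₀
  obtain ⟨k, hk⟩ := γ.exists_desc p ψ fun m n hm hn => by
    rw [← sub_eq_zero]
    refine ((hN p m hm hp).mono hM (Nat.le_succ i)).eq_zero_of_precomp η hH _ ?_
    rw [Preadditive.comp_sub, hψ, ← hψ n (hm.trans hn), ← Category.assoc, ← Functor.map_comp,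
      ← c.map_comp, sub_eq_zero]
    rfl
  refine ⟨k, ?_⟩
  rw [← γ.map_germ_id, Category.assoc, hk p le_rfl]
  have : ψ p le_rfl = l₀ := by
    rw [← hψ p le_rfl]
    have e : c.map (homOfLE (le_refl p)) = 𝟙 _ := c.map_id p
    rw [e, CategoryTheory.Functor.map_id, Category.id_comp]
  rw [this]

end Orthogonal

namespace MapClose

variable {i : ℕ} {a b : ℕ ⥤ S} {A B : RMod S} {α : SeqColimit a A} {β : SeqColimit b B}
  {F : A ⟶ B}

lemma mono (hM : IsGoodMetric M) {j : ℕ} (hij : i ≤ j) (h : MapClose M j α β F) :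
    MapClose M i α β F := by
  obtain ⟨N, hN⟩ := h
  exact ⟨N, fun n hn => (hN n hn).mono hM hij⟩

lemma exists_lift (hF : MapClose M i α β F) {T : S} (hT : (M i).leftOrthogonal T)
    (χ : (yonedaMod S).obj T ⟶ B) : ∃ ψ : (yonedaMod S).obj T ⟶ A, ψ ≫ F = χ := by
  obtain ⟨N, hN⟩ := hF
  obtain ⟨w, rfl⟩ := (hN N le_rfl).exists_lift hT χ
  exact ⟨α.germ w, by rw [← Category.assoc, SeqColimit.map_germ_id]⟩

lemma lift_unique (hM : IsGoodMetric M) (hF : MapClose M (i + 1) α β F) {T : S}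
    (hT : (M i).leftOrthogonal T) (ψ : (yonedaMod S).obj T ⟶ A) (hψ : ψ ≫ F = 0) : ψ = 0 := by
  obtain ⟨N, hN⟩ := hF
  obtain ⟨n, hn, g, rfl⟩ := α.exists_germ_eq ψ N
  rw [← α.map_germ_id, Category.assoc] at hψ
  rw [(hN n hn).lift_unique hM hT g hψ, SeqColimit.germ_zero]

section Orthogonal

variable {h : ℕ ⥤ S} {H : RMod S}

lemma eq_zero_of_precomp (hM : IsGoodMetric M) (hb : IsCauchy coneRel M b)
    (η : SeqColimit h H) (hH : KillsBall M i H) (hF : MapClose M i α β F) (k : B ⟶ H)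
    (hk : F ≫ k = 0) : k = 0 := by
  obtain ⟨N, hN⟩ := hF
  exact (hN N le_rfl).eq_zero_of_precomp hM hb η hH k (by rw [Category.assoc, hk, comp_zero])

lemma exists_extend [IsTriangulated S] (hM : IsGoodMetric M) (ha : IsCauchy coneRel M a)
    (hb : IsCauchy coneRel M b) (η : SeqColimit h H) (hH : KillsBall M i H)
    (hF : MapClose M (i + 1) α β F) (l : A ⟶ H) : ∃ k : B ⟶ H, F ≫ k = l := by
  obtain ⟨N, hN⟩ := hF
  obtain ⟨N', hN'⟩ := exists_closeTo_germ_id hM α ha i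
  obtain ⟨k, hk⟩ := (hN (max N N') (le_max_left _ _)).exists_extend hM hb η hH
    (α.germ (𝟙 _) ≫ l)
  refine ⟨k, ?_⟩
  rw [← sub_eq_zero]
  refine (hN' (max N N') (le_max_right _ _)).eq_zero_of_precomp hM ha η hH _ ?_
  rw [Preadditive.comp_sub, ← hk, Category.assoc, sub_self]

end Orthogonal

variable [IsTriangulated S]

lemma _root_.MetricCompletion.CloseTo.postcomp (hM : IsGoodMetric M) (hb : IsCauchy coneRel M b)
    {X : S} {φ : (yonedaMod S).obj X ⟶ A} (hφ : CloseTo M i α φ) (hF : MapClose M i α β F) :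
    CloseTo M i β (φ ≫ F) := by
  obtain ⟨N, hN⟩ := hF
  obtain ⟨p, hp, g, rfl, hg⟩ := hφ.exists_germ_eq N
  rw [← α.map_germ_id, Category.assoc]
  exact (hN p hp).precomp hM hb hg

/-- Closeness of a map may be tested on one sufficiently close map out of a representable. -/
lemma of_closeTo (hM : IsGoodMetric M) {X : S} {φ : (yonedaMod S).obj X ⟶ A}
    (hφ : CloseTo M (i + 1) α φ) (h : CloseTo M i β (φ ≫ F)) : MapClose M i α β F := by
  obtain ⟨N, hN⟩ := hφ
  obtain ⟨p, hp, g, hg⟩ := α.exists_germ_eq φ N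
  refine ⟨p, fun n hn => ?_⟩
  have e : α.germ (g ≫ a.map (homOfLE hn)) = φ := by rw [SeqColimit.germ_map, hg]
  exact CloseTo.cancel hM (hN n (by lia) _ e) (by rwa [← Category.assoc, α.map_germ_id, e])

end MapClose

/-! ### Representing maps of colimits by maps of sequences -/

/-- Every map `colim Y(a_*) ⟶ colim Y(b_*)` is the colimit of a map from `a_*` to a subsequence
of `b_*`, which may be chosen as sparse as desired. -/
lemma exists_natTrans {C : Type u} [Category.{v} C] [Preadditive C] {a b : ℕ ⥤ C} {A B : RMod C}
    (α : SeqColimit a A) (β : SeqColimit b B) (F : A ⟶ B) (P : ℕ → ℕ) :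
    ∃ (ψ : ℕ → ℕ) (hψ : StrictMono ψ) (f : a ⟶ subseq b hψ), (∀ n, P n ≤ ψ n) ∧
      ∀ n, β.germ (n := ψ n) (f.app n) = α.germ (𝟙 (a.obj n)) ≫ F := by
  let Q (n : ℕ) := { x : Σ p, a.obj n ⟶ b.obj p //
    β.germ x.2 = α.germ (𝟙 (a.obj n)) ≫ F ∧ P n ≤ x.1 }
  have start : Nonempty (Q 0) := by
    obtain ⟨p, hp, g, hg⟩ := β.exists_germ_eq (α.germ (𝟙 (a.obj 0)) ≫ F) (P 0)
    exact ⟨⟨⟨p, g⟩, hg, hp⟩⟩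
  have step (n : ℕ) (x : Q n) : ∃ (y : Q (n + 1)) (h : x.1.1 < y.1.1),
      a.map (homOfLE n.le_succ) ≫ y.1.2 = x.1.2 ≫ b.map (homOfLE h.le) := by
    obtain ⟨q, -, g, hg⟩ := β.exists_germ_eq (α.germ (𝟙 (a.obj (n + 1))) ≫ F) 0
    obtain ⟨m, hm, h₁, h₂, e⟩ := β.exists_comp_map_eq x.1.2 (a.map (homOfLE n.le_succ) ≫ g) (by
      rw [← β.map_germ, hg, x.2.1, ← α.germ_map (𝟙 _) (homOfLE n.le_succ), Category.id_comp,
        ← α.map_germ_id (a.map _), Category.assoc]) (max (x.1.1 + 1) (P (n + 1)))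
    refine ⟨⟨⟨m, g ≫ b.map (homOfLE h₂)⟩, ?_, ?_⟩, ?_, ?_⟩
    · dsimp only
      rw [SeqColimit.germ_map, hg]
    · dsimp only
      lia
    · dsimp only
      lia
    · rw [e, Category.assoc]
  choose next lt comm using step
  let x (n : ℕ) : Q n := Nat.rec start.some next n
  exact ⟨fun n => (x n).1.1, strictMono_nat_of_lt_succ fun n => lt n (x n),
    NatTrans.ofSequence (G := subseq b _) (fun n => (x n).1.2) fun n => comm n (x n),
    fun n => (x n).2.2, fun n => (x n).2.1⟩

end CloseMaps

/-! ### The suspension of modules -/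

section Suspension

variable {S : Type u} [Category.{v} S] [Preadditive S] [HasShift S ℤ]
  [∀ n : ℤ, (shiftFunctor S n).Additive]

/-- The map `Y(ΣX) ≅ ΣY(X) ⟶ ΣA` induced by a map `Y(X) ⟶ A`. -/
def suspend {X : S} {A : RMod S} (φ : (yonedaMod S).obj X ⟶ A) :
    (yonedaMod S).obj (X⟦(1 : ℤ)⟧) ⟶ (shiftMod S).obj A :=
  yonedaShift X ≫ (shiftMod S).map φ

lemma suspend_comp {X : S} {A B : RMod S} (φ : (yonedaMod S).obj X ⟶ A) (F : A ⟶ B) :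
    suspend (φ ≫ F) = suspend φ ≫ (shiftMod S).map F := by
  rw [suspend, suspend, Functor.map_comp, Category.assoc]

lemma toElem_suspend {X : S} {A : RMod S} (φ : (yonedaMod S).obj X ⟶ A) :
    toElem (suspend φ) =
      A.obj.map ((shiftFunctorCompIsoId S (1 : ℤ) (-1) (by norm_num)).hom.app X).op (toElem φ) := by
  refine Eq.trans ?_ (app_eq_map_toElem φ _)
  change φ.hom.app (op ((X⟦(1 : ℤ)⟧)⟦(-1 : ℤ)⟧)) (homShift (X⟦(1 : ℤ)⟧) X (𝟙 _)) = _
  simp [homShift]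

lemma map_suspend {X Z : S} {A : RMod S} (k : Z ⟶ X) (φ : (yonedaMod S).obj X ⟶ A) :
    suspend ((yonedaMod S).map k ≫ φ) = (yonedaMod S).map (k⟦(1 : ℤ)⟧') ≫ suspend φ := by
  refine toElem_injective ?_
  rw [toElem_suspend, toElem_map_comp, app_eq_map_toElem, toElem_map_comp, app_eq_map_toElem,
    toElem_suspend]
  change _ = A.obj.map ((k⟦(1 : ℤ)⟧')⟦(-1 : ℤ)⟧').op _
  rw [← ConcreteCategory.comp_apply, ← ConcreteCategory.comp_apply, ← Functor.map_comp,
    ← Functor.map_comp, ← op_comp, ← op_comp]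
  congr 3
  exact congrArg _ ((shiftFunctorCompIsoId S (1 : ℤ) (-1) (by norm_num)).hom.naturality k).symm

lemma suspend_injective {X : S} {A : RMod S} {φ ψ : (yonedaMod S).obj X ⟶ A}
    (h : suspend φ = suspend ψ) : φ = ψ := by
  have h' := congrArg toElem h
  rw [toElem_suspend, toElem_suspend] at h'
  exact toElem_injective (((ConcreteCategory.isIso_iff_bijective _).1 inferInstance).1 h')

lemma exists_suspend_eq {X : S} {A : RMod S}
    (χ : (yonedaMod S).obj (X⟦(1 : ℤ)⟧) ⟶ (shiftMod S).obj A) : ∃ φ, suspend φ = χ := by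
  have e : IsIso (A.obj.map
      ((shiftFunctorCompIsoId S (1 : ℤ) (-1) (by norm_num)).hom.app X).op) := inferInstance
  obtain ⟨x, hx⟩ : ∃ x : A.obj.obj (op X), A.obj.map
      ((shiftFunctorCompIsoId S (1 : ℤ) (-1) (by norm_num)).hom.app X).op x =
        (show ((shiftMod S).obj A).obj.obj (op (X⟦(1 : ℤ)⟧)) from toElem χ) :=
    ((ConcreteCategory.isIso_iff_bijective _).1 e).2 _
  refine ⟨ofElem x, toElem_injective ?_⟩
  rw [toElem_suspend, toElem_ofElem, hx]

lemma suspend_zero {X : S} {A : RMod S} : suspend (0 : (yonedaMod S).obj X ⟶ A) = 0 := by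
  have h := map_suspend (0 : X ⟶ X) (0 : (yonedaMod S).obj X ⟶ A)
  rwa [comp_zero, Functor.map_zero, Functor.map_zero, zero_comp] at h

variable {k : ℕ ⥤ S} {K : RMod S}

lemma SeqColimit.exists_shift (κ : SeqColimit k K) :
    ∃ κ' : SeqColimit (k ⋙ shiftFunctor S (1 : ℤ)) ((shiftMod S).obj K),
      ∀ n, κ'.ι.app n = suspend (κ.ι.app n) := by
  let e (Z : S) : Z⟦(-1 : ℤ)⟧⟦(1 : ℤ)⟧ ≅ Z := shiftNegShift Z (1 : ℤ)
  have germ_shift {X : S} {n : ℕ} (g : X ⟶ k.obj n) :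
      (yonedaMod S).map (g⟦(1 : ℤ)⟧') ≫ suspend (κ.ι.app n) = suspend (κ.germ g) :=
    (map_suspend g _).symm
  obtain ⟨κ', h⟩ := SeqColimit.nonempty_of_cocone (E := k ⋙ shiftFunctor S (1 : ℤ))
    (F := (shiftMod S).obj K)
    { app := fun n => suspend (κ.ι.app n)
      naturality := fun m n h => by
        have w : (yonedaMod S).map (k.map h) ≫ κ.ι.app n = κ.ι.app m :=
          (κ.ι.naturality h).trans (Category.comp_id _)
        change (yonedaMod S).map ((k.map h)⟦(1 : ℤ)⟧') ≫ suspend (κ.ι.app n) =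
          suspend (κ.ι.app m) ≫ 𝟙 _
        rw [Category.comp_id]
        exact (map_suspend _ _).symm.trans (congrArg suspend w) } (by
      intro Z ψ
      obtain ⟨φ, hφ⟩ := exists_suspend_eq ((yonedaMod S).map (e Z).hom ≫ ψ)
      obtain ⟨n, -, g, rfl⟩ := κ.exists_germ_eq φ 0
      refine ⟨n, (e Z).inv ≫ g⟦(1 : ℤ)⟧', ?_⟩
      rw [Functor.map_comp, Category.assoc]
      refine (congrArg _ ((germ_shift g).trans hφ)).trans ?_
      rw [← Category.assoc, ← Functor.map_comp, Iso.inv_hom_id, CategoryTheory.Functor.map_id,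
        Category.id_comp]) (by
      intro Z n g hg
      change Z ⟶ (k.obj n)⟦(1 : ℤ)⟧ at g
      obtain ⟨g', hg'⟩ := (shiftFunctor S (1 : ℤ)).map_surjective ((e Z).hom ≫ g)
      have h0 : κ.germ g' = 0 := suspend_injective (by
        rw [← germ_shift, hg', suspend_zero, Functor.map_comp, Category.assoc]
        exact (congrArg _ hg).trans comp_zero)
      obtain ⟨m, hm, h⟩ := κ.exists_comp_map_eq_zero _ h0
      refine ⟨m, hm, ?_⟩
      have h' : (e Z).hom ≫ g ≫ (k.map (homOfLE hm))⟦(1 : ℤ)⟧' = 0 := by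
        rw [← Category.assoc, ← hg', ← Functor.map_comp, h, Functor.map_zero]
      rwa [← cancel_epi (e Z).hom, comp_zero])
  exact ⟨κ', fun n => by rw [h]⟩

/-- The suspension of a colimit of representables is the colimit of the suspended sequence. -/
def SeqColimit.shift (κ : SeqColimit k K) :
    SeqColimit (k ⋙ shiftFunctor S (1 : ℤ)) ((shiftMod S).obj K) :=
  κ.exists_shift.choose

lemma SeqColimit.shift_germ (κ : SeqColimit k K) {Z : S} {n : ℕ} (g : Z ⟶ (k.obj n)⟦(1 : ℤ)⟧) :
    κ.shift.germ (n := n) g = (yonedaMod S).map g ≫ suspend (κ.germ (𝟙 (k.obj n))) := by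
  rw [germ_id, ← κ.exists_shift.choose_spec]
  rfl

lemma SeqColimit.shift_germ_map (κ : SeqColimit k K) {X : S} {n : ℕ} (g : X ⟶ k.obj n) :
    κ.shift.germ (n := n) (g⟦(1 : ℤ)⟧') = suspend (κ.germ g) := by
  rw [shift_germ, ← map_suspend, map_germ_id]

end Suspension

/-! ### Strong triangles -/

section Represents

variable {C : Type u} [Category.{v} C] [Preadditive C] {a b c : ℕ ⥤ C} {A B D : RMod C}
  {α : SeqColimit a A} {β : SeqColimit b B} {γ : SeqColimit c D}

/-- The map `F : colim Y(a_*) ⟶ colim Y(b_*)` is the colimit of the map of sequences `f`. -/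
def Represents (α : SeqColimit a A) (β : SeqColimit b B) (f : a ⟶ b) (F : A ⟶ B) : Prop :=
  ∀ n, α.germ (𝟙 (a.obj n)) ≫ F = β.germ (f.app n)

lemma represents_iff {f : a ⟶ b} {F : A ⟶ B} : Represents α β f F ↔
    ∀ n, α.ι.app n ≫ F = (yonedaMod C).map (f.app n) ≫ β.ι.app n :=
  forall_congr' fun n => by rw [SeqColimit.germ_id]; rfl

lemma exists_represents (α : SeqColimit a A) (β : SeqColimit b B) (f : a ⟶ b) :
    ∃ F, Represents α β f F := by
  obtain ⟨F, hF⟩ := α.exists_desc 0 (fun n _ => β.germ (f.app n)) fun m n _ h => by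
    rw [β.map_germ, f.naturality, β.germ_map]
  exact ⟨F, fun n => hF n n.zero_le⟩

namespace Represents

variable {f : a ⟶ b} {F : A ⟶ B} {g : b ⟶ c} {G : B ⟶ D}

lemma germ_comp (h : Represents α β f F) {X : C} {n : ℕ} (u : X ⟶ a.obj n) :
    α.germ u ≫ F = β.germ (u ≫ f.app n) := by
  rw [← α.map_germ_id, Category.assoc, h, β.map_germ]

lemma comp_eq_zero (hf : Represents α β f F) (hg : Represents β γ g G)
    (h : ∀ n, f.app n ≫ g.app n = 0) : F ≫ G = 0 :=
  α.hom_ext 0 fun n _ => by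
    rw [comp_zero, ← Category.assoc, hf, hg.germ_comp, h, SeqColimit.germ_zero]

/-- A sequential colimit of exact sequences is exact. -/
lemma exact (hf : Represents α β f F) (hg : Represents β γ g G)
    (h : ∀ (n : ℕ) (X : C) (u : X ⟶ b.obj n), u ≫ g.app n = 0 → ∃ w, u = w ≫ f.app n)
    {X : C} (χ : (yonedaMod C).obj X ⟶ B) (hχ : χ ≫ G = 0) : ∃ ψ, ψ ≫ F = χ := by
  obtain ⟨n, -, u, rfl⟩ := β.exists_germ_eq χ 0
  rw [hg.germ_comp] at hχ
  obtain ⟨m, hm, h0⟩ := γ.exists_comp_map_eq_zero _ hχ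
  rw [Category.assoc, ← g.naturality, ← Category.assoc] at h0
  obtain ⟨w, hw⟩ := h m X _ h0
  exact ⟨α.germ w, by rw [hf.germ_comp, ← hw, β.germ_map]⟩

end Represents

end Represents

section Strong

variable {S : Type u} [Category.{v} S] [Preadditive S] [HasZeroObject S] [HasShift S ℤ]
  [∀ n : ℤ, (shiftFunctor S n).Additive] [Pretriangulated S]
  {M : ℕ → ObjectProperty S}

lemma KillsBall.shift (hM : IsGoodMetric M) {i : ℕ} {K : RMod S}
    (hK : KillsBall M i K) : KillsBall M (i + 1) ((shiftMod S).obj K) := by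
  intro X hX f
  let e : X⟦(-1 : ℤ)⟧⟦(1 : ℤ)⟧ ≅ X := shiftNegShift X (1 : ℤ)
  obtain ⟨φ, hφ⟩ := exists_suspend_eq ((yonedaMod S).map e.hom ≫ f)
  rw [hK _ (hM.shift_neg _ _ hX) φ, suspend_zero] at hφ
  rwa [← cancel_epi ((yonedaMod S).map e.hom), comp_zero, eq_comm]

/-- Chosen sequences of triangles whose colimit is the strong triangle `A ⟶ B ⟶ D ⟶ ΣA`. -/
structure TriangleRep (M : ℕ → ObjectProperty S) {A B D : RMod S} (F : A ⟶ B) (G : B ⟶ D)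
    (H : D ⟶ (shiftMod S).obj A) where
  /-- the sequence of first objects -/
  a : ℕ ⥤ S
  /-- the sequence of second objects -/
  b : ℕ ⥤ S
  /-- the sequence of third objects -/
  c : ℕ ⥤ S
  /-- the first maps -/
  f : a ⟶ b
  /-- the second maps -/
  g : b ⟶ c
  /-- the third maps -/
  h : c ⟶ a ⋙ shiftFunctor S (1 : ℤ)
  /-- the first colimit -/
  α : SeqColimit a A
  /-- the second colimit -/
  β : SeqColimit b B
  /-- the third colimit -/
  γ : SeqColimit c D
  isCauchy : IsCauchyTriangleSeq M f g h
  rep₁ : Represents α β f F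
  rep₂ : Represents β γ g G
  rep₃ : Represents γ α.shift h H

lemma isStrongTriangle_iff {A B D : RMod S} {F : A ⟶ B} {G : B ⟶ D}
    {H : D ⟶ (shiftMod S).obj A} :
    IsStrongTriangle M F G H ↔ Nonempty (TriangleRep M F G H) := by
  have key {a c : ℕ ⥤ S} (h : c ⟶ a ⋙ shiftFunctor S (1 : ℤ)) (α : SeqColimit a A)
      (γ : SeqColimit c D) : Represents γ α.shift h H ↔ ∀ n, γ.ι.app n ≫ H =
        (yonedaMod S).map (h.app n) ≫ yonedaShift (a.obj n) ≫ (shiftMod S).map (α.ι.app n) :=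
    forall_congr' fun n => by
      rw [SeqColimit.germ_id, SeqColimit.shift_germ, SeqColimit.germ_id]
      rfl
  constructor
  · rintro ⟨a, b, c, f, g, h, α, β, γ, hT, h₁, h₂, h₃⟩
    exact ⟨⟨a, b, c, f, g, h, α, β, γ, hT, represents_iff.2 h₁, represents_iff.2 h₂,
      (key h α γ).2 h₃⟩⟩
  · rintro ⟨⟨a, b, c, f, g, h, α, β, γ, hT, h₁, h₂, h₃⟩⟩
    exact ⟨a, b, c, f, g, h, α, β, γ, hT, represents_iff.1 h₁, represents_iff.1 h₂,
      (key h α γ).1 h₃⟩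

namespace TriangleRep

variable {A B D : RMod S} {F : A ⟶ B} {G : B ⟶ D} {H : D ⟶ (shiftMod S).obj A}

lemma comp₁₂ (T : TriangleRep M F G H) : F ≫ G = 0 :=
  T.rep₁.comp_eq_zero T.rep₂ fun n => comp_distTriang_mor_zero₁₂ _ (T.isCauchy.distinguished n)

lemma comp₂₃ (T : TriangleRep M F G H) : G ≫ H = 0 :=
  T.rep₂.comp_eq_zero T.rep₃ fun n => comp_distTriang_mor_zero₂₃ _ (T.isCauchy.distinguished n)

lemma exact₂ (T : TriangleRep M F G H) {X : S} (χ : (yonedaMod S).obj X ⟶ B)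
    (hχ : χ ≫ G = 0) : ∃ ψ, ψ ≫ F = χ :=
  T.rep₁.exact T.rep₂
    (fun n _ u hu => Triangle.coyoneda_exact₂ _ (T.isCauchy.distinguished n) u hu) χ hχ

lemma exact₃ (T : TriangleRep M F G H) {X : S} (χ : (yonedaMod S).obj X ⟶ D)
    (hχ : χ ≫ H = 0) : ∃ ψ, ψ ≫ G = χ :=
  T.rep₂.exact T.rep₃
    (fun n _ u hu => Triangle.coyoneda_exact₃ _ (T.isCauchy.distinguished n) u hu) χ hχ

/-- Exactness at the first object; the condition only involves the third map of the triangle. -/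
lemma comp_eq_zero_iff (T : TriangleRep M F G H) {X : S} (φ : (yonedaMod S).obj X ⟶ A) :
    φ ≫ F = 0 ↔ ∃ χ : (yonedaMod S).obj (X⟦(1 : ℤ)⟧) ⟶ D, χ ≫ H = suspend φ := by
  obtain ⟨n, -, u, rfl⟩ := T.α.exists_germ_eq φ 0
  constructor
  · intro h
    rw [T.rep₁.germ_comp] at h
    obtain ⟨m, hm, h0⟩ := T.β.exists_comp_map_eq_zero _ h
    rw [Category.assoc, ← T.f.naturality, ← Category.assoc] at h0
    obtain ⟨w, hw⟩ : ∃ w : X⟦(1 : ℤ)⟧ ⟶ T.c.obj m,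
        (u ≫ T.a.map (homOfLE hm))⟦(1 : ℤ)⟧' = w ≫ T.h.app m := by
      refine Triangle.coyoneda_exact₁ _ (T.isCauchy.distinguished m) _ ?_
      change (u ≫ T.a.map (homOfLE hm))⟦(1 : ℤ)⟧' ≫ (T.f.app m)⟦(1 : ℤ)⟧' = 0
      rw [← Functor.map_comp, h0, Functor.map_zero]
    refine ⟨T.γ.germ w, ?_⟩
    rw [T.rep₃.germ_comp, ← hw, SeqColimit.shift_germ_map, SeqColimit.germ_map]
  · rintro ⟨χ, hχ⟩
    obtain ⟨m, -, w, rfl⟩ := T.γ.exists_germ_eq χ 0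
    rw [T.rep₃.germ_comp, ← SeqColimit.shift_germ_map] at hχ
    obtain ⟨p, -, h₁, h₂, e⟩ := T.α.shift.exists_comp_map_eq _ _ hχ 0
    have e' : (u ≫ T.a.map (homOfLE h₂))⟦(1 : ℤ)⟧' =
        (w ≫ T.c.map (homOfLE h₁)) ≫ T.h.app p := by
      rw [Category.assoc, T.h.naturality, ← Category.assoc, e, Functor.map_comp]
      rfl
    have h31 : T.h.app p ≫ (T.f.app p)⟦(1 : ℤ)⟧' = 0 :=
      comp_distTriang_mor_zero₃₁ _ (T.isCauchy.distinguished p)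
    have h0 : (u ≫ T.a.map (homOfLE h₂)) ≫ T.f.app p = 0 := by
      apply (shiftFunctor S (1 : ℤ)).map_injective
      rw [Functor.map_comp, e', Category.assoc, h31, comp_zero, Functor.map_zero]
    rw [← SeqColimit.germ_map _ u (homOfLE h₂), T.rep₁.germ_comp, h0, SeqColimit.germ_zero]

lemma killsBall₁ (hM : IsGoodMetric M) (T : TriangleRep M F G H) {i : ℕ} (hB : KillsBall M i B)
    (hD : KillsBall M i D) : KillsBall M (i + 1) A := by
  intro X hX φ
  obtain ⟨χ, hχ⟩ := (T.comp_eq_zero_iff φ).1 (hB X (hM.le _ _ hX) _)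
  rw [hD _ (hM.shift_pos _ _ hX) χ, zero_comp, ← suspend_zero] at hχ
  exact (suspend_injective hχ).symm

end TriangleRep

end Strong

/-! ### Uniqueness and existence of strong triangles -/

section Comparison

variable {S : Type u} [Category.{v} S] [Preadditive S] [HasZeroObject S] [HasShift S ℤ]
  [∀ n : ℤ, (shiftFunctor S n).Additive] [Pretriangulated S] [IsTriangulated S]
  {M : ℕ → ObjectProperty S}

namespace TriangleRep

/-- The first object of a strong triangle is determined by the second map. A comparison map is
constructed on one late term of the sequence of first objects; it extends to the colimit, and all
commutations may be checked on late terms, because the targets are orthogonal to a ball. -/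
lemma nonempty_iso₁ (hM : IsGoodMetric M) {A A' B D : RMod S} {F : A ⟶ B} {F' : A' ⟶ B}
    {G : B ⟶ D} {H : D ⟶ (shiftMod S).obj A} {H' : D ⟶ (shiftMod S).obj A'}
    (T : TriangleRep M F G H) (T' : TriangleRep M F' G H') {r : ℕ} (hA' : KillsBall M r A')
    (hB : KillsBall M r B) : Nonempty (A ≅ A') := by
  obtain ⟨N₁, hN₁⟩ := exists_closeTo_germ_id hM T.α T.isCauchy.cauchy₁ (r + 1)
  obtain ⟨N₂, hN₂⟩ := exists_closeTo_germ_id hM T.γ T.isCauchy.cauchy₃ (r + 1)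
  let n := max N₁ N₂
  have hα := hN₁ n (le_max_left _ _)
  have hγ := hN₂ n (le_max_right _ _)
  -- a commutative square `b_n ⟶ c_n`, `b'_m ⟶ c'_m` representing the identities of `B` and `D`
  obtain ⟨m, u, w, hu, hw, comm⟩ : ∃ (m : ℕ) (u : T.b.obj n ⟶ T'.b.obj m)
      (w : T.c.obj n ⟶ T'.c.obj m), T'.β.germ u = T.β.germ (𝟙 (T.b.obj n)) ∧
        T'.γ.germ w = T.γ.germ (𝟙 (T.c.obj n)) ∧ T.g.app n ≫ w = u ≫ T'.g.app m := by
    obtain ⟨p, -, u, hu⟩ := T'.β.exists_germ_eq (T.β.germ (𝟙 (T.b.obj n))) 0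
    obtain ⟨q, -, w, hw⟩ := T'.γ.exists_germ_eq (T.γ.germ (𝟙 (T.c.obj n))) 0
    obtain ⟨m, -, h₁, h₂, e⟩ := T'.γ.exists_comp_map_eq (T.g.app n ≫ w) (u ≫ T'.g.app p) (by
      rw [← SeqColimit.map_germ, hw, SeqColimit.map_germ_id, ← T'.rep₂.germ_comp, hu, T.rep₂]) 0
    refine ⟨m, u ≫ T'.b.map (homOfLE h₂), w ≫ T'.c.map (homOfLE h₁), ?_, ?_, ?_⟩
    · rw [SeqColimit.germ_map, hu]
    · rw [SeqColimit.germ_map, hw]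
    · rw [← Category.assoc, e, Category.assoc, Category.assoc, T'.g.naturality]
  obtain ⟨t, ht₁, ht₂⟩ : ∃ t : T.a.obj n ⟶ T'.a.obj m, T.f.app n ≫ u = t ≫ T'.f.app m ∧
      T.h.app n ≫ t⟦(1 : ℤ)⟧' = w ≫ T'.h.app m :=
    complete_distinguished_triangle_morphism₁ _ _ (T.isCauchy.distinguished n)
      (T'.isCauchy.distinguished m) u w comm
  obtain ⟨k, hk⟩ := hα.exists_extend hM T.isCauchy.cauchy₁ T'.α hA' (T'.α.germ t)
  have hkF : k ≫ F' = F := by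
    rw [← sub_eq_zero]
    refine (hα.mono hM (Nat.le_succ r)).eq_zero_of_precomp hM T.isCauchy.cauchy₁ T'.β hB _ ?_
    rw [Preadditive.comp_sub, ← Category.assoc, hk, T'.rep₁.germ_comp, ← ht₁,
      ← SeqColimit.map_germ, hu, SeqColimit.map_germ_id, T.rep₁, sub_self]
  have hkH : H ≫ (shiftMod S).map k = H' := by
    rw [← sub_eq_zero]
    refine hγ.eq_zero_of_precomp hM T.isCauchy.cauchy₃ T'.α.shift (hA'.shift hM) _ ?_
    rw [Preadditive.comp_sub, ← Category.assoc, T.rep₃, SeqColimit.shift_germ, Category.assoc,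
      ← suspend_comp, hk, ← SeqColimit.shift_germ_map, SeqColimit.map_germ, ht₂,
      ← T'.rep₃.germ_comp, hw, sub_self]
  -- the five lemma, tested on maps out of representables
  have : IsIso k := by
    refine isIso_of_bijective k (fun X φ hφ => ?_) (fun X φ => ?_)
    · have h0 : φ ≫ F = 0 := by rw [← hkF, ← Category.assoc, hφ, zero_comp]
      obtain ⟨χ, hχ⟩ := (T.comp_eq_zero_iff φ).1 h0
      have h1 : χ ≫ H' = 0 := by
        rw [← hkH, ← Category.assoc, hχ, ← suspend_comp, hφ, suspend_zero]
      obtain ⟨χ', rfl⟩ := T'.exact₃ χ h1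
      rw [Category.assoc, T.comp₂₃, comp_zero, ← suspend_zero] at hχ
      exact (suspend_injective hχ).symm
    · obtain ⟨φ₁, hφ₁⟩ := T.exact₂ (φ ≫ F') (by rw [Category.assoc, T'.comp₁₂, comp_zero])
      have h0 : (φ - φ₁ ≫ k) ≫ F' = 0 := by
        rw [Preadditive.sub_comp, Category.assoc, hkF, hφ₁, sub_self]
      obtain ⟨χ, hχ⟩ := (T'.comp_eq_zero_iff _).1 h0
      obtain ⟨φ₂, hφ₂⟩ := exists_suspend_eq (χ ≫ H)
      refine ⟨φ₁ + φ₂, ?_⟩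
      have h1 : φ₂ ≫ k = φ - φ₁ ≫ k := suspend_injective (by
        rw [suspend_comp, hφ₂, Category.assoc, hkH, hχ])
      rw [Preadditive.add_comp, h1, add_sub_cancel]
  exact ⟨asIso k⟩

/-- The second object of a strong triangle is determined by the third map. -/
lemma exists_iso₂ (hM : IsGoodMetric M) {A B B' D : RMod S} {F : A ⟶ B} {F' : A ⟶ B'}
    {G : B ⟶ D} {G' : B' ⟶ D} {H : D ⟶ (shiftMod S).obj A}
    (T : TriangleRep M F G H) (T' : TriangleRep M F' G' H) {r : ℕ} (hB' : KillsBall M r B')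
    (hD : KillsBall M r D) : ∃ e : B ≅ B', e.hom ≫ G' = G := by
  obtain ⟨N₁, hN₁⟩ := exists_closeTo_germ_id hM T.α T.isCauchy.cauchy₁ r
  obtain ⟨N₂, hN₂⟩ := exists_closeTo_germ_id hM T.β T.isCauchy.cauchy₂ (r + 1)
  let n := max N₁ N₂
  have hα := hN₁ n (le_max_left _ _)
  have hβ := hN₂ n (le_max_right _ _)
  -- a commutative square `c_n ⟶ Σa_n`, `c'_m ⟶ Σa'_m` representing the identities of `D` and `ΣA`
  obtain ⟨m, u, w, hu, hw, comm⟩ : ∃ (m : ℕ) (u : T.a.obj n ⟶ T'.a.obj m)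
      (w : T.c.obj n ⟶ T'.c.obj m), T'.α.germ u = T.α.germ (𝟙 (T.a.obj n)) ∧
        T'.γ.germ w = T.γ.germ (𝟙 (T.c.obj n)) ∧
        T.h.app n ≫ u⟦(1 : ℤ)⟧' = w ≫ T'.h.app m := by
    obtain ⟨p, -, u, hu⟩ := T'.α.exists_germ_eq (T.α.germ (𝟙 (T.a.obj n))) 0
    obtain ⟨q, -, w, hw⟩ := T'.γ.exists_germ_eq (T.γ.germ (𝟙 (T.c.obj n))) 0
    obtain ⟨m, -, h₁, h₂, e⟩ := T'.α.shift.exists_comp_map_eq (n := p) (n' := q)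
      (T.h.app n ≫ u⟦(1 : ℤ)⟧') (w ≫ T'.h.app q) (by
        rw [← T'.rep₃.germ_comp, hw, T.rep₃, ← SeqColimit.map_germ,
          SeqColimit.shift_germ_map, hu, SeqColimit.shift_germ]) 0
    refine ⟨m, u ≫ T'.a.map (homOfLE h₁), w ≫ T'.c.map (homOfLE h₂), ?_, ?_, ?_⟩
    · rw [SeqColimit.germ_map, hu]
    · rw [SeqColimit.germ_map, hw]
    · rw [Functor.map_comp, ← Category.assoc, Category.assoc w, T'.h.naturality, ← Category.assoc]
      exact e
  obtain ⟨t, ht₁, ht₂⟩ : ∃ t : T.b.obj n ⟶ T'.b.obj m, T.f.app n ≫ t = u ≫ T'.f.app m ∧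
      T.g.app n ≫ w = t ≫ T'.g.app m :=
    complete_distinguished_triangle_morphism₂ _ _ (T.isCauchy.distinguished n)
      (T'.isCauchy.distinguished m) u w comm
  obtain ⟨k, hk⟩ := hβ.exists_extend hM T.isCauchy.cauchy₂ T'.β hB' (T'.β.germ t)
  have hkG : k ≫ G' = G := by
    rw [← sub_eq_zero]
    refine (hβ.mono hM (Nat.le_succ r)).eq_zero_of_precomp hM T.isCauchy.cauchy₂ T'.γ hD _ ?_
    rw [Preadditive.comp_sub, ← Category.assoc, hk, T'.rep₂.germ_comp, ← ht₂,
      ← SeqColimit.map_germ, hw, SeqColimit.map_germ_id, T.rep₂, sub_self]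
  have hkF : F ≫ k = F' := by
    rw [← sub_eq_zero]
    refine hα.eq_zero_of_precomp hM T.isCauchy.cauchy₁ T'.β hB' _ ?_
    rw [Preadditive.comp_sub, ← Category.assoc, T.rep₁, ← T.β.map_germ_id, Category.assoc, hk,
      SeqColimit.map_germ, ht₁, ← T'.rep₁.germ_comp, hu, sub_self]
  -- the five lemma, tested on maps out of representables
  have : IsIso k := by
    refine isIso_of_bijective k (fun X φ hφ => ?_) (fun X φ => ?_)
    · obtain ⟨φ', rfl⟩ := T.exact₂ φ (by rw [← hkG, ← Category.assoc, hφ, zero_comp])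
      rw [Category.assoc, hkF] at hφ
      exact (T.comp_eq_zero_iff φ').2 ((T'.comp_eq_zero_iff φ').1 hφ)
    · obtain ⟨φ₁, hφ₁⟩ := T.exact₃ (φ ≫ G') (by rw [Category.assoc, T'.comp₂₃, comp_zero])
      obtain ⟨φ₂, hφ₂⟩ := T'.exact₂ (φ - φ₁ ≫ k) (by
        rw [Preadditive.sub_comp, Category.assoc, hkG, hφ₁, sub_self])
      refine ⟨φ₁ + φ₂ ≫ F, ?_⟩
      rw [Preadditive.add_comp, Category.assoc, hkF, hφ₂, add_sub_cancel]
  exact ⟨asIso k, hkG⟩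

end TriangleRep

/-- A map represented by a map of Cauchy sequences is the second map of a strong triangle
represented by fibres of that map of sequences. -/
lemma exists_triangleRep (hM : IsGoodMetric M) {b c : ℕ ⥤ S} {B D : RMod S} {β : SeqColimit b B}
    {γ : SeqColimit c D} (hb : IsCauchy coneRel M b) (hc : IsCauchy coneRel M c) {g : b ⟶ c}
    {G : B ⟶ D} (hg : Represents β γ g G) :
    ∃ (A : RMod S) (F : A ⟶ B) (H : D ⟶ (shiftMod S).obj A) (T : TriangleRep M F G H),
      ∀ i, (∀ n, IsClose M (i + 1) (g.app n)) → ∀ n, M i (T.a.obj n) := by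
  obtain ⟨a, f, h, hT⟩ := exists_isCauchyTriangleSeq_of_second hM g hb hc
  let α := SeqColimit.ofSeq a
  obtain ⟨F, hF⟩ := exists_represents α β f
  obtain ⟨H, hH⟩ := exists_represents γ α.shift h
  refine ⟨_, F, H, ⟨a, b, c, f, g, h, α, β, γ, hT, hF, hg, hH⟩, fun i hi n => ?_⟩
  have h1 : M (i + 1) ((a.obj n)⟦(1 : ℤ)⟧) :=
    (hi n).of_coneRel hM ⟨_, _, rot_of_distTriang _ (hT.distinguished n)⟩
  exact hM.of_iso (shiftShiftNeg (a.obj n) (1 : ℤ)) (hM.shift_neg _ _ h1)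

lemma exists_triangleRep_of_map (hM : IsGoodMetric M) {b c : ℕ ⥤ S} {B D : RMod S}
    (β : SeqColimit b B) (γ : SeqColimit c D) (hb : IsCauchy coneRel M b)
    (hc : IsCauchy coneRel M c) (G : B ⟶ D) :
    ∃ (A : RMod S) (F : A ⟶ B) (H : D ⟶ (shiftMod S).obj A),
      Nonempty (TriangleRep M F G H) := by
  obtain ⟨ψ, hψ, g, -, hg⟩ := exists_natTrans β γ G (fun n => n)
  obtain ⟨A, F, H, T, -⟩ := exists_triangleRep hM (γ := γ.subseq hψ) hb
    (hM.isCauchy_subseq hc hψ) (g := g) (G := G) fun n => by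
      rw [← hg]
      exact (γ.subseq_germ hψ (g.app n)).symm
  exact ⟨A, F, H, ⟨T⟩⟩

/-- The fibre of a close map in `𝔖(S)` lies in a ball of the completion. -/
lemma TriangleRep.ball_of_mapClose (hM : IsGoodMetric M) {i r : ℕ} {K X Z : RMod S}
    {F : K ⟶ X} {G : X ⟶ Z} {H : Z ⟶ (shiftMod S).obj K} (T : TriangleRep M F G H)
    (hX : KillsBall M r X) (hZ : KillsBall M r Z) {x z : ℕ ⥤ S} {ξ : SeqColimit x X}
    {ζ : SeqColimit z Z} (hx : IsCauchy coneRel M x) (hz : IsCauchy coneRel M z)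
    (hG : MapClose M (i + 1) ξ ζ G) : ℒ M i K := by
  obtain ⟨N, hN⟩ := hG
  choose P hP using hN
  have hφ : StrictMono (fun n => n + N) := fun _ _ h => Nat.add_lt_add_right h N
  obtain ⟨ψ, hψ, g, hψP, hg⟩ := exists_natTrans (ξ.subseq hφ) ζ G
    (fun n => P (n + N) (Nat.le_add_left N n))
  have hg' (n : ℕ) : ζ.germ (n := ψ n) (g.app n) = ξ.germ (𝟙 (x.obj (n + N))) ≫ G :=
    (hg n).trans (congrArg (· ≫ G) (ξ.subseq_germ hφ (n := n) (𝟙 (x.obj (n + N)))))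
  obtain ⟨K', F', H', T', hT'⟩ := exists_triangleRep hM (γ := ζ.subseq hψ)
    (hM.isCauchy_subseq hx hφ) (hM.isCauchy_subseq hz hψ) (g := g) (G := G) fun n => by
      rw [← hg]
      exact (ζ.subseq_germ hψ (g.app n)).symm
  obtain ⟨e⟩ := T'.nonempty_iso₁ hM T (T.killsBall₁ hM hX hZ)
    (hX.mono hM (Nat.le_succ r))
  exact ⟨T'.a, T'.isCauchy.cauchy₁, hT' i fun n => hP _ _ _ (hψP n) _ (hg' n),
    ⟨T'.α.ofIso e⟩⟩

/-- If the fibre of `X ⟶ Z` lies in a ball, then the source has a representing sequence with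
respect to which the map is close, for any given sequence representing the target. -/
lemma TriangleRep.exists_mapClose (hM : IsGoodMetric M) {i r : ℕ} {K X Z : RMod S}
    {F : K ⟶ X} {G : X ⟶ Z} {H : Z ⟶ (shiftMod S).obj K} (T : TriangleRep M F G H)
    (hX : KillsBall M r X) (hZ : KillsBall M r Z) (hK : ℒ M (i + 1) K) {z : ℕ ⥤ S}
    (ζ : SeqColimit z Z) (hz : IsCauchy coneRel M z) :
    ∃ (x : ℕ ⥤ S) (ξ : SeqColimit x X), IsCauchy coneRel M x ∧ MapClose M i ξ ζ G := by
  obtain ⟨k, hk, hkM, ⟨κ⟩⟩ := hK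
  obtain ⟨ψ, hψ, h, -, hh⟩ := exists_natTrans ζ κ.shift H (fun n => n)
  let h' : z ⟶ subseq k hψ ⋙ shiftFunctor S (1 : ℤ) := h
  obtain ⟨x, f, g, hT⟩ := exists_isCauchyTriangleSeq_of_third hM h' (hM.isCauchy_subseq hk hψ) hz
  let ξ := SeqColimit.ofSeq x
  obtain ⟨F', hF'⟩ := exists_represents (κ.subseq hψ) ξ f
  obtain ⟨G', hG'⟩ := exists_represents ξ ζ g
  have hH : Represents ζ (κ.subseq hψ).shift h' H := fun n => by
    rw [SeqColimit.shift_germ, ← hh]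
    exact (κ.shift_germ (n := ψ n) (h.app n)).trans
      (congrArg (fun t => (yonedaMod S).map (h.app n) ≫ suspend t)
        (κ.subseq_germ hψ (𝟙 (k.obj (ψ n)))).symm)
  let T' : TriangleRep M F' G' H := ⟨_, _, _, f, g, h', _, ξ, ζ, hT, hF', hG', hH⟩
  obtain ⟨e, he⟩ := T'.exists_iso₂ hM T hX hZ
  obtain ⟨N, hN⟩ := exists_closeTo_germ_id hM ζ hz i
  refine ⟨x, ξ.ofIso e, hT.cauchy₂, N, fun n hn => ?_⟩
  rw [SeqColimit.ofIso_germ, Category.assoc, he, hG', ← ζ.map_germ_id]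
  exact (hN n hn).precomp hM hz
    ⟨_, ⟨_, _, rot_of_distTriang _ (hT.distinguished n)⟩, hM.shift_pos _ _ (hkM (ψ n))⟩

/-- A map `Y(X) ⟶ D` of type `m` with respect to the constant sequence is `m`-close. -/
lemma IsOfType.closeTo (hM : IsGoodMetric M) {m : ℕ} {X : S} {d : ℕ ⥤ S} {D : RMod S}
    {δ : SeqColimit d D} {F : (yonedaMod S).obj X ⟶ D} (hd : IsCauchy coneRel M d)
    (h : IsOfType M m (constSeqColimit X) δ F) : CloseTo M m δ F := by
  obtain ⟨φ, ψ, hφ, hψ, f, hf, hm⟩ := h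
  obtain ⟨c, g, k, hT⟩ := exists_isCauchyTriangleSeq hM f
    (hM.isCauchy_subseq (hM.isCauchy_const X) hφ) (hM.isCauchy_subseq hd hψ)
  obtain ⟨N, hN⟩ := hm c g k hT
  refine CloseTo.of_frequently hM hd fun N' => ⟨ψ (max N N'),
    (le_max_right N N').trans (hψ.id_le _), f.app (max N N'), ?_, _,
    ⟨_, _, hT.distinguished _⟩, hN _ (le_max_left _ _)⟩
  exact (hf (max N N')).symm.trans (Category.id_comp _)

end Comparison

/-! ### Approximating objects of the completion by objects of `𝔖(S)` -/

section Approximation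

variable {S : Type u} [Category.{v} S] [Preadditive S] [HasZeroObject S] [HasShift S ℤ]
  [∀ n : ℤ, (shiftFunctor S n).Additive] [Pretriangulated S]
  {M : ℕ → ObjectProperty S}

lemma exists_killsBall {D : RMod S} (hD : 𝔖 M D) : ∃ r, KillsBall M r D := hD.2

lemma exists_killsBall₂ (hM : IsGoodMetric M) {D D' : RMod S} (hD : 𝔖 M D) (hD' : 𝔖 M D') :
    ∃ r, KillsBall M r D ∧ KillsBall M r D' := by
  obtain ⟨r, hr⟩ := exists_killsBall hD
  obtain ⟨r', hr'⟩ := exists_killsBall hD'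
  exact ⟨max r r', hr.mono hM (le_max_left _ _), hr'.mono hM (le_max_right _ _)⟩

lemma strictMono_add (N : ℕ) : StrictMono (fun n : ℕ => n + N) :=
  fun _ _ h => Nat.add_lt_add_right h N

lemma ball_of_eventually_mem (hM : IsGoodMetric M) {l : ℕ} {d : ℕ ⥤ S} {D : RMod S}
    (δ : SeqColimit d D) (hd : IsCauchy coneRel M d) {N : ℕ} (h : ∀ n, N ≤ n → M l (d.obj n)) :
    ℒ M l D :=
  ⟨subseq d (strictMono_add N), hM.isCauchy_subseq hd _, fun n => h (n + N) (Nat.le_add_left N n),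
    ⟨δ.subseq _⟩⟩

lemma MapClose.ball_target (hM : IsGoodMetric M) {l : ℕ} {a d : ℕ ⥤ S} {A D : RMod S}
    {α : SeqColimit a A} {δ : SeqColimit d D} {F : A ⟶ D} (h : MapClose M l α δ F)
    (hd : IsCauchy coneRel M d) (ha : ∀ n, M l (a.obj n)) : ℒ M l D := by
  obtain ⟨N, hN⟩ := h
  obtain ⟨p₀, hp₀⟩ := hN N le_rfl
  obtain ⟨p, hp, g, hg⟩ := δ.exists_germ_eq (α.germ (𝟙 (a.obj N)) ≫ F) p₀
  exact ball_of_eventually_mem hM δ hd (N := p) fun q hq =>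
    (hp₀ q (hp.trans hq) (g ≫ d.map (homOfLE hq)) (by rw [δ.germ_map, hg])).target_mem hM (ha N)

lemma MapClose.eventually_source_mem (hM : IsGoodMetric M) {l : ℕ} {a d : ℕ ⥤ S} {A D : RMod S}
    {α : SeqColimit a A} {δ : SeqColimit d D} {F : A ⟶ D} (h : MapClose M (l + 1) α δ F) {N : ℕ}
    (hd : ∀ n, N ≤ n → M l (d.obj n)) : ∃ N', ∀ n, N' ≤ n → M l (a.obj n) := by
  obtain ⟨N', hN'⟩ := h
  refine ⟨N', fun n hn => ?_⟩
  obtain ⟨p, hp, g, -, hg⟩ := (hN' n hn).exists_germ_eq N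
  exact hg.source_mem hM (hd p hp)

/-- An inverse sequence in `𝔖(S)` under `A = colim Y(a_*)` approximates `A` if it contains terms
to which `A` maps by arbitrarily close maps. -/
structure IsApprox {a : ℕ ⥤ S} {A : RMod S} (α : SeqColimit a A)
    (D : ℕ ⥤ (𝔖 M).FullSubcategoryᵒᵖ) (π : ∀ j, A ⟶ (D.obj j).unop.obj) : Prop where
  comp_map : ∀ i j (h : i ≤ j), π j ≫ (D.map (homOfLE h)).unop.hom = π i
  close : ∀ i N, ∃ j, N ≤ j ∧ ∃ (d : ℕ ⥤ S) (δ : SeqColimit d (D.obj j).unop.obj),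
    IsCauchy coneRel M d ∧ MapClose M i α δ (π j)

variable [IsTriangulated S]

/-- If `D_*` approximates `A`, then `Ŷ(A)` is the colimit of the representables on `D_*`, because
a module `B ∈ 𝔖(S)` does not distinguish `A` from its close approximations. -/
lemma IsApprox.nonempty_seqColimit (hM : IsGoodMetric M) {a : ℕ ⥤ S} {A : RMod S}
    {α : SeqColimit a A} (ha : IsCauchy coneRel M a) {D : ℕ ⥤ (𝔖 M).FullSubcategoryᵒᵖ}
    {π : ∀ j, A ⟶ (D.obj j).unop.obj} (h : IsApprox α D π) :
    Nonempty (SeqColimit D (yHatObj M (op A))) := by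
  let p (j : ℕ) : (yonedaMod _).obj (D.obj j) ⟶ yHatObj M (op A) :=
    ofElem (F := yHatObj M (op A)) (π j)
  have key {Z : (𝔖 M).FullSubcategoryᵒᵖ} {j : ℕ} (g : Z ⟶ D.obj j) :
      toElem ((yonedaMod _).map g ≫ p j) = (π j ≫ g.unop.hom : A ⟶ Z.unop.obj) :=
    toElem_map_comp g (p j)
  obtain ⟨δ, -⟩ := SeqColimit.nonempty_of_cocone (E := D) (F := yHatObj M (op A))
    { app := p
      naturality := fun i j k => by
        change (yonedaMod _).map (D.map k) ≫ p j = p i ≫ 𝟙 _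
        rw [Category.comp_id]
        refine toElem_injective ?_
        rw [key]
        exact (h.comp_map i j (leOfHom k)).trans
          (toElem_ofElem (F := yHatObj M (op A)) (π i)).symm } (by
      intro Z φ
      obtain ⟨r, hr⟩ := exists_killsBall Z.unop.property
      obtain ⟨_, -, ⟨ζ⟩⟩ := Z.unop.property.1
      obtain ⟨j, -, d, δ, hd, hj⟩ := h.close (r + 1) 0
      obtain ⟨k, hk⟩ := hj.exists_extend hM ha hd ζ hr (toElem φ : A ⟶ Z.unop.obj)
      exact ⟨j, (ObjectProperty.homMk k).op, toElem_injective ((key _).trans hk)⟩) (by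
      intro Z n g hg
      obtain ⟨r, hr⟩ := exists_killsBall Z.unop.property
      obtain ⟨_, -, ⟨ζ⟩⟩ := Z.unop.property.1
      obtain ⟨j, hn, d, δ, hd, hj⟩ := h.close r n
      have h0 : π n ≫ g.unop.hom = 0 := (key g).symm.trans (congrArg toElem hg)
      refine ⟨j, hn, ?_⟩
      have h1 : (D.map (homOfLE hn)).unop.hom ≫ g.unop.hom = 0 :=
        hj.eq_zero_of_precomp hM hd ζ hr _ (by
          rw [← Category.assoc, h.comp_map, h0])
      exact Quiver.Hom.unop_inj (ObjectProperty.hom_ext _ h1))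
  exact ⟨δ⟩

/-- Every object of the completion is close to an object of `𝔖(S)` which is orthogonal to a ball
depending only on the required closeness. -/
lemma IsExcellent.exists_mapClose (hM : IsExcellent M) (m : ℕ) : ∃ n, m < n ∧
    ∀ {a : ℕ ⥤ S} {A : RMod S} (α : SeqColimit a A), IsCauchy coneRel M a →
      ∃ (D : RMod S) (d : ℕ ⥤ S) (δ : SeqColimit d D) (G : A ⟶ D), IsCauchy coneRel M d ∧
        𝔖 M D ∧ KillsBall M n D ∧ MapClose M m α δ G := by
  have hM' := hM.toIsGoodMetric
  obtain ⟨n, hmn, h⟩ := hM.exists_type m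
  refine ⟨n, hmn, fun {a A} α ha => ?_⟩
  obtain ⟨N, hN⟩ := exists_closeTo_germ_id hM' α ha (n + 1)
  obtain ⟨D, d, δ, ψ, hd, hD, hDn, hψ⟩ := h (a.obj N)
  have hkill : KillsBall M n D := fun X hX f =>
    hDn f ⟨_, hM'.isCauchy_const X, fun _ => hX, ⟨constSeqColimit X⟩⟩
  obtain ⟨G, rfl⟩ := (hN N le_rfl).exists_extend hM' ha δ hkill ψ
  exact ⟨D, d, δ, G, hd, hD, hkill, MapClose.of_closeTo hM'
    ((hN N le_rfl).mono hM' (by lia)) (hψ.closeTo hM' hd)⟩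

/-- Every object of the completion is approximated by a Cauchy sequence in `𝔖(S)ᵒᵖ`. -/
lemma IsExcellent.exists_isApprox (hM : IsExcellent M) {a : ℕ ⥤ S} {A : RMod S}
    (α : SeqColimit a A) (ha : IsCauchy coneRel M a) (m₀ : ℕ) :
    ∃ (D : ℕ ⥤ (𝔖 M).FullSubcategoryᵒᵖ) (π : ∀ j, A ⟶ (D.obj j).unop.obj),
      IsApprox α D π ∧ IsCauchy (coneRelOp M) (fun i => (𝒩 M i).op) D ∧
      ((∀ n, M m₀ (a.obj n)) → ∀ j, 𝒩 M m₀ (D.obj j).unop) := by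
  have hM' := hM.toIsGoodMetric
  choose ν hν step using hM.exists_mapClose
  -- the gap in `m (k + 1) = ν (m k) + 1` makes the transition maps exist
  let m (k : ℕ) : ℕ := Nat.rec m₀ (fun _ i => ν i + 1) k
  have hm_succ (k : ℕ) : m (k + 1) = ν (m k) + 1 := rfl
  have hm : StrictMono m := strictMono_nat_of_lt_succ fun k => by
    have := hν (m k)
    rw [hm_succ]
    lia
  choose X d δ G hd hX hkill hG using fun k => step (m k) α ha
  choose t ht using fun k => (hG (k + 1)).exists_extend hM' ha (hd (k + 1)) (δ k) (hkill k) (G k)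
  let D : ℕ ⥤ (𝔖 M).FullSubcategoryᵒᵖ := Functor.ofSequence
    (X := fun k => op ⟨X k, hX k⟩) fun k => Quiver.Hom.op (ObjectProperty.homMk (t k))
  have comp_map (i j : ℕ) (h : i ≤ j) : G j ≫ (D.map (homOfLE h)).unop.hom = G i := by
    induction j, h using Nat.le_induction with
    | base =>
      have : D.map (homOfLE (le_refl i)) = 𝟙 _ := D.map_id i
      rw [this]
      exact Category.comp_id _
    | succ j h ih =>
      have : D.map (homOfLE (h.trans j.le_succ)) =
          D.map (homOfLE h) ≫ D.map (homOfLE j.le_succ) := by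
        rw [← D.map_comp]
        rfl
      rw [this, Functor.ofSequence_map_homOfLE_succ, ← ih, ← ht j]
      exact (Category.assoc _ _ _).symm
  refine ⟨D, G, ⟨comp_map, fun i N => ⟨max i N, le_max_right _ _, d _, δ _, hd _, ?_⟩⟩,
    fun i => ⟨i + 1, fun p q hpq hp K hK => ?_⟩, fun ha' j => ?_⟩
  · exact (hG _).mono hM' ((le_max_left _ _).trans (hm.id_le _))
  · obtain ⟨g, h, hT⟩ := hK
    obtain ⟨T⟩ := isStrongTriangle_iff.1 hT
    obtain ⟨r, hr, hr'⟩ := exists_killsBall₂ hM' (hX q) (hX p)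
    obtain ⟨N, hN⟩ := hG q
    obtain ⟨N', hN'⟩ := hG p
    have hp' : i + 1 ≤ m p := hp.trans (hm.id_le p)
    have hq' : i + 1 + 1 ≤ m q := (Nat.succ_le_succ hp').trans (hm hpq)
    have hclose (f : X q ⟶ X p) (hf : G q ≫ f = G p) : MapClose M (i + 1) (δ q) (δ p) f :=
      MapClose.of_closeTo hM' ((hN (max N N') (le_max_left _ _)).mono hM' hq') (by
        rw [Category.assoc, hf]
        exact (hN' (max N N') (le_max_right _ _)).mono hM' hp')
    exact T.ball_of_mapClose hM' hr hr' (hd q) (hd p) (hclose _ (comp_map p q hpq.le))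
  · exact ((hG j).mono hM' (hm.monotone j.zero_le)).ball_target hM' (hd j) ha'

end Approximation

/-! ### The functor `Ŷ` is fully faithful on the completion -/

section FullyFaithful

variable {S : Type u} [Category.{v} S] [Preadditive S] [HasZeroObject S] [HasShift S ℤ]
  [∀ n : ℤ, (shiftFunctor S n).Additive] [Pretriangulated S]
  {M : ℕ → ObjectProperty S}

namespace IsApprox

variable {b : ℕ ⥤ S} {B : RMod S} {β : SeqColimit b B} {D : ℕ ⥤ (𝔖 M).FullSubcategoryᵒᵖ}
  {π : ∀ j, B ⟶ (D.obj j).unop.obj}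

lemma eq_zero_of_comp (hM : IsExcellent M) (h : IsApprox β D π) {X : S}
    (φ : (yonedaMod S).obj X ⟶ B) (hφ : ∀ j, φ ≫ π j = 0) : φ = 0 := by
  obtain ⟨r, hr⟩ := hM.exists_leftOrthogonal X
  obtain ⟨j, -, d, δ, -, hj⟩ := h.close (r + 1) 0
  exact hj.lift_unique hM.toIsGoodMetric hr φ (hφ j)

lemma hom_ext (hM : IsExcellent M) (h : IsApprox β D π) {A : RMod S} {k l : A ⟶ B}
    (hkl : ∀ j, k ≫ π j = l ≫ π j) : k = l :=
  hom_ext_yoneda fun X φ => sub_eq_zero.1 (h.eq_zero_of_comp hM _ fun j => by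
    rw [Preadditive.sub_comp, Category.assoc, Category.assoc, hkl, sub_self])

/-- An object of the completion is the limit of its approximations, tested on representables:
each `X` is left orthogonal to some `M r`, so a map out of `Y(X)` lifts along close maps. -/
lemma exists_lift (hM : IsExcellent M) (h : IsApprox β D π) {X : S}
    (g : ∀ j, (yonedaMod S).obj X ⟶ (D.obj j).unop.obj)
    (hg : ∀ i j (hij : i ≤ j), g j ≫ (D.map (homOfLE hij)).unop.hom = g i) :
    ∃ φ : (yonedaMod S).obj X ⟶ B, ∀ j, φ ≫ π j = g j := by
  obtain ⟨r, hr⟩ := hM.exists_leftOrthogonal X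
  obtain ⟨j₀, -, d, δ, -, hj₀⟩ := h.close (r + 1) 0
  have lift (N : ℕ) : ∃ j, N ≤ j ∧ ∃ φ : (yonedaMod S).obj X ⟶ B, φ ≫ π j = g j := by
    obtain ⟨j, hj, d, δ, -, hc⟩ := h.close r N
    exact ⟨j, hj, hc.exists_lift hr (g j)⟩
  have down {i j : ℕ} (hij : i ≤ j) {φ : (yonedaMod S).obj X ⟶ B} (hφ : φ ≫ π j = g j) :
      φ ≫ π i = g i := by
    rw [← h.comp_map i j hij, ← Category.assoc, hφ, hg]
  obtain ⟨j₁, hj₁, φ, hφ⟩ := lift j₀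
  refine ⟨φ, fun j => ?_⟩
  obtain ⟨j₂, hj₂, φ', hφ'⟩ := lift (max j j₀)
  have e : φ' = φ := sub_eq_zero.1 (hj₀.lift_unique hM.toIsGoodMetric hr _ (by
    rw [Preadditive.sub_comp, down ((le_max_right _ _).trans hj₂) hφ', down hj₁ hφ, sub_self]))
  rw [← e]
  exact down ((le_max_left _ _).trans hj₂) hφ'

lemma exists_hom (hM : IsExcellent M) (h : IsApprox β D π) {a : ℕ ⥤ S} {A : RMod S}
    (α : SeqColimit a A) (g : ∀ j, A ⟶ (D.obj j).unop.obj)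
    (hg : ∀ i j (hij : i ≤ j), g j ≫ (D.map (homOfLE hij)).unop.hom = g i) :
    ∃ k : A ⟶ B, ∀ j, k ≫ π j = g j := by
  choose φ hφ using fun n => h.exists_lift hM (fun j => α.germ (𝟙 (a.obj n)) ≫ g j)
    fun i j hij => by rw [Category.assoc, hg]
  obtain ⟨k, hk⟩ := α.exists_desc 0 (fun n _ => φ n) fun m n _ hmn =>
    sub_eq_zero.1 (h.eq_zero_of_comp hM _ fun j => by
      rw [Preadditive.sub_comp, Category.assoc, hφ, hφ, ← Category.assoc, α.map_germ_id,
        ← α.germ_map (𝟙 _) (homOfLE hmn), Category.id_comp, sub_self])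
  exact ⟨k, fun j => α.hom_ext 0 fun n hn => by rw [← Category.assoc, hk n hn, hφ]⟩

end IsApprox

variable [IsTriangulated S]

lemma IsExcellent.yHat_map_injective (hM : IsExcellent M) {A B : RMod S} (hB : 𝔏 M B)
    {k l : A ⟶ B} (hkl : (yHat M).map k.op = (yHat M).map l.op) : k = l := by
  obtain ⟨b, hb, ⟨β⟩⟩ := hB
  obtain ⟨D, π, h, -, -⟩ := hM.exists_isApprox β hb 0
  refine h.hom_ext hM fun j => ?_
  exact congrArg (fun θ : yHatObj M (op B) ⟶ yHatObj M (op A) =>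
    (θ.hom.app (op (D.obj j)) (π j) : A ⟶ (D.obj j).unop.obj)) hkl

lemma IsExcellent.yHat_map_surjective (hM : IsExcellent M) {A B : RMod S} (hA : 𝔏 M A)
    (hB : 𝔏 M B) (θ : yHatObj M (op B) ⟶ yHatObj M (op A)) :
    ∃ k : A ⟶ B, (yHat M).map k.op = θ := by
  have hM' := hM.toIsGoodMetric
  obtain ⟨a, ha, ⟨α⟩⟩ := hA
  obtain ⟨b, hb, ⟨β⟩⟩ := hB
  obtain ⟨D, π, h, -, -⟩ := hM.exists_isApprox β hb 0
  let θ' (Z : (𝔖 M).FullSubcategory) (t : B ⟶ Z.obj) : A ⟶ Z.obj := θ.hom.app (op (op Z)) t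
  have nat {Z W : (𝔖 M).FullSubcategory} (f : Z ⟶ W) (t : B ⟶ Z.obj) :
      θ' W (t ≫ f.hom) = θ' Z t ≫ f.hom :=
    ConcreteCategory.congr_hom (θ.hom.naturality f.op.op) t
  obtain ⟨k, hk⟩ := h.exists_hom hM α (fun j => θ' _ (π j)) fun i j hij => by
    rw [← nat, h.comp_map]
  refine ⟨k, ObjectProperty.hom_ext _ (NatTrans.ext (funext fun Z =>
    AddCommGrpCat.ext fun t => ?_))⟩
  change (B ⟶ Z.unop.unop.obj) at t
  change k ≫ t = θ' Z.unop.unop t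
  obtain ⟨r, hr⟩ := exists_killsBall Z.unop.unop.property
  obtain ⟨_, -, ⟨ζ⟩⟩ := Z.unop.unop.property.1
  obtain ⟨j, -, d, δ, hd, hj⟩ := h.close (r + 1) 0
  obtain ⟨s, rfl⟩ := hj.exists_extend hM' hb hd ζ hr t
  rw [← Category.assoc, hk]
  exact (nat (ObjectProperty.homMk s) (π j)).symm

end FullyFaithful

lemma restrictsToEquivalence_of {C : Type*} [Category* C] {D : Type*} [Category* D] {F : C ⥤ D}
    {P : ObjectProperty C} {Q : ObjectProperty D} (h : ∀ X, P X → Q (F.obj X))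
    (inj : ∀ {X Y : C} {k l : X ⟶ Y}, P X → P Y → F.map k = F.map l → k = l)
    (surj : ∀ {X Y : C} (θ : F.obj X ⟶ F.obj Y), P X → P Y → ∃ k, F.map k = θ)
    (ess : ∀ Z, Q Z → ∃ X, P X ∧ Nonempty (F.obj X ≅ Z)) : RestrictsToEquivalence F P Q := by
  refine ⟨fun X => h X.obj X.property, ?_⟩
  have faithful : (Q.lift (P.ι ⋙ F) fun X => h X.obj X.property).Faithful :=
    ⟨fun {X Y k l} e => ObjectProperty.hom_ext _
      (inj X.property Y.property (congrArg (fun t => t.hom) e))⟩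
  have full : (Q.lift (P.ι ⋙ F) fun X => h X.obj X.property).Full :=
    ⟨fun {X Y} θ => by
      obtain ⟨k, hk⟩ := surj (X := X.obj) (Y := Y.obj) θ.hom X.property Y.property
      exact ⟨ObjectProperty.homMk k, ObjectProperty.hom_ext _ hk⟩⟩
  have essSurj : (Q.lift (P.ι ⋙ F) fun X => h X.obj X.property).EssSurj :=
    ⟨fun Z => by
      obtain ⟨X, hX, ⟨e⟩⟩ := ess Z.obj Z.property
      exact ⟨⟨X, hX⟩, ⟨Q.isoMk e⟩⟩⟩
  exact { }

/-! ### Cauchy sequences in `𝔖(S)ᵒᵖ` come from objects of the completion -/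

section EssentialImage

variable {S : Type u} [Category.{v} S] [Preadditive S] [HasZeroObject S] [HasShift S ℤ]
  [∀ n : ℤ, (shiftFunctor S n).Additive] [Pretriangulated S]
  {M : ℕ → ObjectProperty S}

lemma IsExcellent.exists_isClose_from_leftOrthogonal (hM : IsExcellent M) (m : ℕ) :
    ∃ n, m < n ∧ ∀ F : S, ∃ (E : S) (f : E ⟶ F), (M n).leftOrthogonal E ∧ IsClose M m f := by
  obtain ⟨n, hmn, h⟩ := hM.exists_triangle m
  refine ⟨n, hmn, fun F => ?_⟩
  obtain ⟨T, hT, rfl, h₁, h₃⟩ := h F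
  exact ⟨T.obj₁, T.mor₁, h₁, IsClose.of_distTriang hT h₃⟩

variable [IsTriangulated S]

/-- In a Cauchy sequence of `𝔖(S)ᵒᵖ`, every map has a fibre in `𝔖(S)`, so late maps can be
represented by close maps of sequences, for any given sequence representing the target. -/
lemma exists_mapClose_of_coneRelOp (hM : IsGoodMetric M) {i : ℕ}
    {Z X : (𝔖 M).FullSubcategoryᵒᵖ} (f : Z ⟶ X)
    (h : ∀ K, coneRelOp M f K → (𝒩 M (i + 1)).op K) {z : ℕ ⥤ S}
    (ζ : SeqColimit z Z.unop.obj) (hz : IsCauchy coneRel M z) :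
    ∃ (x : ℕ ⥤ S) (ξ : SeqColimit x X.unop.obj), IsCauchy coneRel M x ∧
      MapClose M i ξ ζ f.unop.hom := by
  obtain ⟨x, hx, ⟨ξ⟩⟩ := X.unop.property.1
  obtain ⟨r, hr, hr'⟩ := exists_killsBall₂ hM X.unop.property Z.unop.property
  obtain ⟨K, F, H, ⟨T⟩⟩ := exists_triangleRep_of_map hM ξ ζ hx hz f.unop.hom
  have hK : 𝔖 M K := ⟨⟨T.a, T.isCauchy.cauchy₁, ⟨T.α⟩⟩, ⟨r + 1, T.killsBall₁ hM hr hr'⟩⟩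
  exact T.exists_mapClose hM hr hr' (h (op ⟨K, hK⟩)
    ⟨ObjectProperty.homMk F, H, isStrongTriangle_iff.2 ⟨T⟩⟩) ζ hz

/-- Compatible, increasingly close maps from the terms of a Cauchy sequence `e_*` to those of an
inverse sequence in `𝔖(S)` make the latter an approximation of the colimit of `Y(e_*)`. -/
lemma exists_isApprox_of_closeTo (hM : IsGoodMetric M) {D : ℕ ⥤ (𝔖 M).FullSubcategoryᵒᵖ}
    {e : ℕ ⥤ S} {B : RMod S} (β : SeqColimit e B) (he : IsCauchy coneRel M e)
    (q : ∀ k, (yonedaMod S).obj (e.obj k) ⟶ (D.obj k).unop.obj)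
    (hq : ∀ i, ∃ N, ∀ k, N ≤ k → ∃ (d : ℕ ⥤ S) (δ : SeqColimit d (D.obj k).unop.obj),
      IsCauchy coneRel M d ∧ CloseTo M i δ (q k))
    (hs : ∀ k, (yonedaMod S).map (e.map (homOfLE k.le_succ)) ≫ q (k + 1) ≫
      (D.map (homOfLE k.le_succ)).unop.hom = q k) :
    ∃ Q, IsApprox β D Q := by
  let t {i j : ℕ} (h : i ≤ j) : (D.obj j).unop.obj ⟶ (D.obj i).unop.obj :=
    (D.map (homOfLE h)).unop.hom
  have t_comp {i j k : ℕ} (hij : i ≤ j) (hjk : j ≤ k) : t hjk ≫ t hij = t (hij.trans hjk) :=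
    congrArg (fun f => f.unop.hom) (D.map_comp (homOfLE hij) (homOfLE hjk)).symm
  have t_refl (i : ℕ) : t (le_refl i) = 𝟙 (D.obj i).unop.obj :=
    congrArg (fun f => f.unop.hom) (D.map_id i)
  have hs' (k : ℕ) : (yonedaMod S).map (e.map (homOfLE k.le_succ)) ≫ q (k + 1) ≫
      t k.le_succ = q k := hs k
  have hqt {j i k : ℕ} (hji : j ≤ i) (hik : i ≤ k) :
      (yonedaMod S).map (e.map (homOfLE hik)) ≫ q k ≫ t (hji.trans hik) = q i ≫ t hji := by
    induction k, hik using Nat.le_induction with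
    | base =>
      have : e.map (homOfLE (le_refl i)) = 𝟙 _ := e.map_id i
      rw [this, CategoryTheory.Functor.map_id, Category.id_comp]
    | succ k hik ih =>
      have : e.map (homOfLE (hik.trans k.le_succ)) =
          e.map (homOfLE hik) ≫ e.map (homOfLE k.le_succ) := by
        rw [← e.map_comp]
        rfl
      rw [this, ← t_comp (hji.trans hik) k.le_succ, Functor.map_comp, Category.assoc, ← ih,
        ← hs' k, Category.assoc, Category.assoc]
  choose Q hQ using fun j => β.exists_desc j (fun k hk => q k ≫ t hk)
    fun i k hji hik => hqt hji hik
  refine ⟨Q, fun i j hij => β.hom_ext j fun k hk => ?_, fun i N => ?_⟩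
  · rw [← Category.assoc, hQ j k hk, hQ i k (hij.trans hk), ← t_comp hij hk, Category.assoc]
  · obtain ⟨N₁, hN₁⟩ := exists_closeTo_germ_id hM β he (i + 1)
    obtain ⟨N₂, hN₂⟩ := hq i
    let j := max N (max N₁ N₂)
    obtain ⟨d, δ, hd, hj⟩ := hN₂ j (by lia)
    refine ⟨j, by lia, d, δ, hd, MapClose.of_closeTo hM (hN₁ j (by lia)) ?_⟩
    rw [hQ j j le_rfl, t_refl, Category.comp_id]
    exact hj

/-- Every colimit of a Cauchy sequence of `𝔖(S)ᵒᵖ` is of the form `Ŷ(B)` with `B` in the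
completion of `S`. -/
lemma IsExcellent.exists_yHatObj_iso (hM : IsExcellent M) {D : ℕ ⥤ (𝔖 M).FullSubcategoryᵒᵖ}
    (hD : IsCauchy (coneRelOp M) (fun i => (𝒩 M i).op) D)
    {F : RMod (𝔖 M).FullSubcategoryᵒᵖ} (δF : SeqColimit D F) (l : ℕ) :
    ∃ B : RMod S, 𝔏 M B ∧ ((∀ j, 𝒩 M l (D.obj j).unop) → ℒ M l B) ∧
      Nonempty (yHatObj M (op B) ≅ F) := by
  have hM' := hM.toIsGoodMetric
  choose ν hν fib using hM.exists_isClose_from_leftOrthogonal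
  let m (k : ℕ) : ℕ := Nat.rec (l + 1) (fun _ i => ν i + 1) k
  have hm_succ (k : ℕ) : m (k + 1) = ν (m k) + 1 := rfl
  have hm : StrictMono m := strictMono_nat_of_lt_succ fun k => by
    have := hν (m k)
    rw [hm_succ]
    lia
  have hml (k : ℕ) : l + 1 ≤ m k := hm.monotone k.zero_le
  -- pass to a subsequence whose transition maps have fibres in small balls
  choose N hN using hD
  obtain ⟨φ, hφ, hNφ⟩ := Filter.extraction_forall_of_eventually
    fun k => Filter.eventually_ge_atTop (N (m (k + 1) + 1))
  let D' : ℕ ⥤ (𝔖 M).FullSubcategoryᵒᵖ := subseq D hφ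
  let X (k : ℕ) : RMod S := (D'.obj k).unop.obj
  let t {i j : ℕ} (h : i ≤ j) : X j ⟶ X i := (D'.map (homOfLE h)).unop.hom
  -- successively choose sequences representing the `X k`, making the transition maps close
  let R (k : ℕ) := { p : Σ d : ℕ ⥤ S, SeqColimit d (X k) // IsCauchy coneRel M p.1 }
  have start : ∃ r : R 0, (∀ j, 𝒩 M l (D.obj j).unop) → ∀ n, M l (r.1.1.obj n) := by
    by_cases h : ∀ j, 𝒩 M l (D.obj j).unop
    · obtain ⟨d, hd, hdl, ⟨δ⟩⟩ := h (φ 0)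
      exact ⟨⟨⟨d, δ⟩, hd⟩, fun _ => hdl⟩
    · obtain ⟨d, hd, ⟨δ⟩⟩ := (D'.obj 0).unop.property.1
      exact ⟨⟨⟨d, δ⟩, hd⟩, fun h' => absurd h' h⟩
  have step (k : ℕ) (r : R k) : ∃ r' : R (k + 1),
      MapClose M (m (k + 1)) r'.1.2 r.1.2 (t k.le_succ) := by
    obtain ⟨x, ξ, hx, h⟩ := exists_mapClose_of_coneRelOp hM' (D'.map (homOfLE k.le_succ))
      (hN _ (φ k) (φ (k + 1)) (hφ k.lt_succ_self) (hNφ k)) r.1.2 r.2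
    exact ⟨⟨⟨x, ξ⟩, hx⟩, h⟩
  obtain ⟨r₀, hr₀⟩ := start
  choose next hnext using step
  let r (k : ℕ) : R k := Nat.rec r₀ next k
  let d (k : ℕ) : ℕ ⥤ S := (r k).1.1
  let δ (k : ℕ) : SeqColimit (d k) (X k) := (r k).1.2
  have hd (k : ℕ) : IsCauchy coneRel M (d k) := (r k).2
  have hδ (k : ℕ) : MapClose M (m (k + 1)) (δ (k + 1)) (δ k) (t k.le_succ) := hnext k (r k)
  have hball (k : ℕ) : ∃ N, (∀ j, 𝒩 M l (D.obj j).unop) → ∀ n, N ≤ n → M l ((d k).obj n) := by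
    induction k with
    | zero => exact ⟨0, fun h n _ => hr₀ h n⟩
    | succ k ih =>
      obtain ⟨N, hN⟩ := ih
      by_cases h : ∀ j, 𝒩 M l (D.obj j).unop
      · obtain ⟨N', hN'⟩ := ((hδ k).mono hM' (hml (k + 1))).eventually_source_mem hM' (hN h)
        exact ⟨N', fun _ => hN'⟩
      · exact ⟨0, fun h' => absurd h' h⟩
  -- objects `E k` of `S` close to `X k` and left orthogonal to a ball
  have hE (k : ℕ) : ∃ (E : S) (q : (yonedaMod S).obj E ⟶ X k), (M (ν (m k))).leftOrthogonal E ∧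
      CloseTo M (m k) (δ k) q ∧ ((∀ j, 𝒩 M l (D.obj j).unop) → M l E) := by
    obtain ⟨N₁, hN₁⟩ := exists_closeTo_germ_id hM' (δ k) (hd k) (m k)
    obtain ⟨N₂, hN₂⟩ := hball k
    obtain ⟨E, f, hE, hf⟩ := fib (m k) ((d k).obj (max N₁ N₂))
    refine ⟨E, (δ k).germ f, hE, ?_, fun h => ?_⟩
    · rw [← (δ k).map_germ_id]
      exact (hN₁ _ (le_max_left _ _)).precomp hM' (hd k) hf
    · exact (hf.mono hM' (hml k)).source_mem hM' (hN₂ h _ (le_max_right _ _))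
  choose E q hEorth hq hEball using hE
  have hs (k : ℕ) : ∃ s : E k ⟶ E (k + 1),
      (yonedaMod S).map s ≫ q (k + 1) ≫ t k.le_succ = q k := by
    have horth : (M (m (k + 1))).leftOrthogonal (E k) := fun Y f hY => hEorth k f (hM.le _ _ hY)
    obtain ⟨ψ, hψ⟩ := (hδ k).exists_lift horth (q k)
    obtain ⟨s, hs⟩ := (hq (k + 1)).exists_lift horth ψ
    exact ⟨s, by rw [← Category.assoc, hs, hψ]⟩
  choose s hs using hs
  have hs_close (k : ℕ) : IsClose M (m k) (s k) := by
    have h₁ : CloseTo M (m k + 1) (δ k) (q (k + 1) ≫ t k.le_succ) :=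
      ((hq (k + 1)).postcomp hM' (hd k) (hδ k)).mono hM' (hm k.lt_succ_self)
    exact h₁.isClose hM' (by rw [hs]; exact hq k)
  obtain ⟨e, q', he, hq', hs', hl⟩ : ∃ (e : ℕ ⥤ S) (q' : ∀ k, (yonedaMod S).obj (e.obj k) ⟶ X k),
      (∀ k, IsClose M (m k) (e.map (homOfLE k.le_succ))) ∧
      (∀ k, CloseTo M (m k) (δ k) (q' k)) ∧
      (∀ k, (yonedaMod S).map (e.map (homOfLE k.le_succ)) ≫ q' (k + 1) ≫ t k.le_succ = q' k) ∧
      ((∀ j, 𝒩 M l (D.obj j).unop) → ∀ k, M l (e.obj k)) := by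
    refine ⟨Functor.ofSequence s, q, fun k => ?_, hq, fun k => ?_, fun h k => hEball k h⟩
    · rw [Functor.ofSequence_map_homOfLE_succ]
      exact hs_close k
    · rw [Functor.ofSequence_map_homOfLE_succ]
      exact hs k
  have hec : IsCauchy coneRel M e :=
    hM'.isCauchy_of_succ fun i => ⟨i, fun n hn => (he n).mono hM' (hn.trans (hm.id_le n))⟩
  let β := SeqColimit.ofSeq e
  obtain ⟨Q, happrox⟩ := exists_isApprox_of_closeTo hM' (D := D') β hec q'
    (fun i => ⟨i, fun k hk => ⟨d k, δ k, hd k, (hq' k).mono hM' (hk.trans (hm.id_le k))⟩⟩) hs'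
  obtain ⟨σ⟩ := happrox.nonempty_seqColimit hM' hec
  exact ⟨_, ⟨e, hec, ⟨β⟩⟩, fun h => ⟨e, hec, hl h, ⟨β⟩⟩,
    ⟨σ.uniqueUpToIso (δF.subseq hφ)⟩⟩

end EssentialImage

end MetricCompletion

end

theorem proposition2 {S : Type u} [CategoryTheory.Category.{v} S]
    [CategoryTheory.Preadditive S] [CategoryTheory.Limits.HasZeroObject S]
    [CategoryTheory.HasShift S ℤ]
    [∀ n : ℤ, (CategoryTheory.shiftFunctor S n).Additive]
    [CategoryTheory.Pretriangulated S] [CategoryTheory.IsTriangulated S]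
    (M : ℕ → CategoryTheory.ObjectProperty S) (hM : MetricCompletion.IsExcellent M) :
    MetricCompletion.RestrictsToEquivalence (MetricCompletion.yHat M)
      (MetricCompletion.𝔏 M).op (MetricCompletion.𝔏Op M) ∧
    ∀ l : ℕ, MetricCompletion.RestrictsToEquivalence (MetricCompletion.yHat M)
      (MetricCompletion.ℒ M l).op (MetricCompletion.ℒOp M l) := by
  have hM' := hM.toIsGoodMetric
  have le (l : ℕ) {A : MetricCompletion.RMod S} (hA : MetricCompletion.ℒ M l A) :
      MetricCompletion.𝔏 M A := by
    obtain ⟨a, ha, -, hα⟩ := hA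
    exact ⟨a, ha, hα⟩
  have inj {X Y : (MetricCompletion.RMod S)ᵒᵖ} {k k' : X ⟶ Y} (hX : MetricCompletion.𝔏 M X.unop)
      (h : (MetricCompletion.yHat M).map k = (MetricCompletion.yHat M).map k') : k = k' :=
    Quiver.Hom.unop_inj (hM.yHat_map_injective hX h)
  have surj {X Y : (MetricCompletion.RMod S)ᵒᵖ}
      (θ : (MetricCompletion.yHat M).obj X ⟶ (MetricCompletion.yHat M).obj Y)
      (hX : MetricCompletion.𝔏 M X.unop) (hY : MetricCompletion.𝔏 M Y.unop) :
      ∃ k, (MetricCompletion.yHat M).map k = θ := by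
    obtain ⟨k, hk⟩ := hM.yHat_map_surjective hY hX θ
    exact ⟨k.op, hk⟩
  constructor
  · refine MetricCompletion.restrictsToEquivalence_of (fun A hA => ?_)
      (fun hX _ h => inj hX h) (fun θ hX hY => surj θ hX hY) (fun Z hZ => ?_)
    · obtain ⟨a, ha, ⟨α⟩⟩ := hA
      obtain ⟨D, π, h, hD, -⟩ := hM.exists_isApprox α ha 0
      exact ⟨D, hD, h.nonempty_seqColimit hM' ha⟩
    · obtain ⟨D, hD, ⟨δ⟩⟩ := hZ
      obtain ⟨B, hB, -, hiso⟩ := hM.exists_yHatObj_iso hD δ 0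
      exact ⟨op B, hB, hiso⟩
  · refine fun l => MetricCompletion.restrictsToEquivalence_of (fun A hA => ?_)
      (fun hX _ h => inj (le l hX) h) (fun θ hX hY => surj θ (le l hX) (le l hY)) (fun Z hZ => ?_)
    · obtain ⟨a, ha, hal, ⟨α⟩⟩ := hA
      obtain ⟨D, π, h, hD, hDl⟩ := hM.exists_isApprox α ha l
      exact ⟨D, hD, hDl hal, h.nonempty_seqColimit hM' ha⟩
    · obtain ⟨D, hD, hDl, ⟨δ⟩⟩ := hZ
      obtain ⟨B, -, hB, hiso⟩ := hM.exists_yHatObj_iso hD δ l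
      exact ⟨op B, hB hDl, hiso⟩
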